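/- Link diagrams are diagrams on the sphere; for a diagram $D$, $c(D)$ is its number of crossings and $\det(D)$ the determinant $|V(-1)|$ ($V$ the Jones polynomial) of the link it represents. A link is quasi-alternating if it belongs to the smallest class of links which contains the unknot and which contains the link of a diagram $D$ whenever $D$ has a crossing $c$ such that the links of both smoothings of $D$ at $c$ are in the class and $\det(D)$ is the sum of their determinants. Let $D$ be an almost alternating link diagram with dealternator $c$ (that is, changing the crossing $c$ makes $D$ alternating), and mark the ends of $c$ as $NW, SW, SE, NE$ so that $c$ is the elementary tangle $-1$ (overstrand of negative slope). Let $D^c_0$ and $D^c_\infty$ be the diagrams obtained by replacing $c$ by the tangles $0$ (arcs $NW$–$NE$ and $SW$–$SE$) and $\infty$ (arcs $NW$–$SW$ and $NE$–$SE$). Suppose that $D$ represents a quasi-alternating link and that $c(D)\le\det(D)$. Then $\det(D^c_0)\ne\det(D^c_\infty)$. Put $\omega=-\tfrac12$ if $\det(D^c_0)>\det(D^c_\infty)$ and $\omega=-2$ if $\det(D^c_0)<\det(D^c_\infty)$, and let $D^{c\leftarrow\omega}$ be the dealternator extension of $D$, i.e. the diagram obtained by replacing $c$ by the vertical ($\omega=-\frac12$)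 or horizontal ($\omega=-2$) twist of two crossings of type $-1$. Let $d$ be either of these two crossings, and let $\mathcal D$ be any rational extension of $D^{c\leftarrow\omega}$ at $d$, that is, the diagram obtained by replacing $d$ by the standard diagram of a rational tangle $[-a_1,\dots,-a_n]=-\bigl(a_1+\tfrac{1}{a_2+\cdots+\frac1{a_n}}\bigr)$ with integers $n\ge1$, $a_1\ge0$, $a_2,\dots,a_n\ge1$, and $a_1\geq 1$ if $n=1$. Then $c(\mathcal D)\le\det(\mathcal D)$. -/

import Mathlib

noncomputable section

/-- The number of orbits of the permutation group generated by `S`. -/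
def numOrbits {α : Type} (S : Set (Equiv.Perm α)) : ℕ :=
  Nat.card (MulAction.orbitRel.Quotient (Subgroup.closure S) α)

/-- The two crossingless elementary tangles. The endpoints of a tangle are numbered
counterclockwise: `0 = NW`, `1 = SW`, `2 = SE`, `3 = NE`. The tangle `0` consists of the arcs
`NW-NE` and `SW-SE`, the tangle `∞` of the arcs `NW-SW` and `SE-NE`. -/
inductive Smoothing : Type
  | zero
  | infty
  deriving DecidableEq

instance : Fintype Smoothing := ⟨{.zero, .infty}, by intro x; cases x <;> simp⟩

/-- The arcs of a smoothing, as an involution of the four endpoints. -/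
def Smoothing.arc : Smoothing → Equiv.Perm (Fin 4)
  | .zero => Equiv.subLeft 3
  | .infty => Equiv.subLeft 1

theorem Smoothing.arc_arc : ∀ (s : Smoothing) (i : Fin 4), s.arc (s.arc i) = i
  | .zero => by decide
  | .infty => by decide

theorem Smoothing.arc_ne : ∀ (s : Smoothing) (i : Fin 4), s.arc i ≠ i
  | .zero => by decide
  | .infty => by decide

/-- The elementary tangles `0`, `∞`, `1`, `-1`. In `pos = 1` the overstrand is `SW-NE`
(positive slope), in `neg = -1` it is `NW-SE` (negative slope). -/
inductive Elementary : Type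
  | smoothed (s : Smoothing)
  | pos
  | neg

namespace Elementary

def IsCrossing : Elementary → Prop
  | smoothed _ => False
  | pos => True
  | neg => True

/-- Whether the endpoint `i` of a crossing belongs to its overstrand. -/
def isOver : Elementary → Fin 4 → Bool
  | smoothed _, _ => false
  | pos, i => decide (i = 1 ∨ i = 3)
  | neg, i => decide (i = 0 ∨ i = 2)

/-- The crossing change. -/
def change : Elementary → Elementary
  | smoothed s => smoothed s
  | pos => neg
  | neg => pos

/-- The arcs of the tangle which do not run through a crossing. -/
def arc : Elementary → Equiv.Perm (Fin 4)
  | smoothed s => s.arc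
  | pos => 1
  | neg => 1

/-- The coefficient of the smoothing `s` in the Kauffman bracket of an elementary tangle. The
`A`-smoothing of a crossing joins the two regions which are swept out when the overstrand is
turned counterclockwise: this is `∞` for the crossing `1` and `0` for the crossing `-1`. -/
def weight (A : ℂ) : Elementary → Smoothing → ℂ
  | smoothed t, s => if s = t then 1 else 0
  | pos, .infty => A
  | pos, .zero => A⁻¹
  | neg, .zero => A
  | neg, .infty => A⁻¹

end Elementary

/-- Counterclockwise rotation by one step around each vertex. -/
def rot (V : Type) : Equiv.Perm (V × Fin 4) :=
  Equiv.prodCongr (Equiv.refl V) (Equiv.addRight 1)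

/-- An unoriented link diagram on an oriented surface, as a combinatorial 4-valent map. At every
vertex `v` there is a small disk whose four endpoints `(v, 0), ..., (v, 3)`, in counterclockwise
order, are the ends of edges; `glue` exchanges the two ends of every edge, and the disk is filled
with the elementary tangle `kind v`. So the crossings of the diagram are the vertices of kind
`±1`; a vertex of kind `0` or `∞` only records two arcs of the diagram passing by each other.
The numbering at a vertex is the marking of the disk as a tangle. -/
structure LinkDiagram : Type 1 where
  V : Type
  [fintypeV : Fintype V]
  [decEqV : DecidableEq V]
  glue : Equiv.Perm (V × Fin 4)
  glue_glue : ∀ d, glue (glue d) = d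
  glue_ne : ∀ d, glue d ≠ d
  kind : V → Elementary

attribute [instance] LinkDiagram.fintypeV LinkDiagram.decEqV

namespace LinkDiagram

variable (D : LinkDiagram)

/-- The ends of the edges of the underlying map. -/
abbrev Dart : Type := D.V × Fin 4

/-- The underlying map lies on a disjoint union of spheres, one for each connected component:
`#vertices - #edges + #faces = 2 * #components`, where `#edges = 2 * #vertices`. -/
def Planar : Prop :=
  numOrbits {rot D.V * D.glue} = Fintype.card D.V + 2 * numOrbits {rot D.V, D.glue}

/-- The crossings of the diagram. -/
abbrev Cr : Type := {v : D.V // (D.kind v).IsCrossing}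

/-- The number `c(D)` of crossings of the diagram. -/
def crossingNumber : ℕ := Nat.card D.Cr

/-- Replace the tangle at the vertex `v` by the elementary tangle `k`. -/
def setKind (v : D.V) (k : Elementary) : LinkDiagram :=
  { D with kind := Function.update D.kind v k }

/-- The smoothings `D^v_0` and `D^v_∞`. -/
def smooth (v : D.V) (s : Smoothing) : LinkDiagram := D.setKind v (.smoothed s)

def crossingChange (v : D.V) : LinkDiagram := D.setKind v (D.kind v).change

/-- Reattach the ends of the edges to the vertices according to `τ`. -/
def reattach (τ : Equiv.Perm D.Dart) : LinkDiagram :=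
  { D with
    glue := τ * D.glue * τ⁻¹
    glue_glue := by intro d; simp [D.glue_glue]
    glue_ne := by
      intro d h
      apply D.glue_ne (τ⁻¹ d)
      apply τ.injective
      simpa using h }

/-! ### The determinant -/

/-- The number of circles of the state in which every vertex `v` carries the smoothing `s v`. -/
def circlesOfState (s : D.V → Smoothing) : ℕ :=
  numOrbits {D.glue, Equiv.prodShear (Equiv.refl D.V) (fun v => (s v).arc)}

/-- The Kauffman bracket, normalised to be `1` on a circle, as a function of `A`. -/
def kauffmanBracket (A : ℂ) : ℂ :=
  ∑ s : D.V → Smoothing,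
    (∏ v, (D.kind v).weight A (s v)) * (-A ^ 2 - A⁻¹ ^ 2) ^ (D.circlesOfState s - 1)

/-- The determinant `|V(-1)|`, where `V` is the Jones polynomial, in the variable `t = A⁻⁴`. At
`A = exp (iπ/4)`, where `t = -1`, the Jones polynomial is the Kauffman bracket up to a power
of `-A³`, which has absolute value `1`. -/
def det : ℝ := ‖D.kauffmanBracket (Complex.exp (Real.pi / 4 * Complex.I))‖

/-! ### Alternating and almost alternating diagrams -/

/-- Along every strand the over- and undercrossings alternate: the ends of the edges can be
labelled over (`true`) or under (`false`), correctly at the crossings, so that the label changes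
along every edge and along every arc passing through a vertex that is not a crossing. -/
def Alternating : Prop :=
  ∃ o : D.Dart → Bool,
    (∀ d, o (D.glue d) = !o d) ∧
    (∀ v i, (D.kind v).IsCrossing → o (v, i) = (D.kind v).isOver i) ∧
    (∀ v i s, D.kind v = .smoothed s → o (v, s.arc i) = !o (v, i))

/-- `c` is a dealternator: a crossing whose change makes the diagram alternating (so that the
diagram is almost alternating). -/
def IsDealternator (c : D.V) : Prop :=
  (D.kind c).IsCrossing ∧ (D.crossingChange c).Alternating

/-! ### Links: diagrams up to planar isotopy and Reidemeister moves -/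

/-- The group of permutations whose orbits are the arcs of the diagram between crossings, and
the circles without crossings. -/
def arcGroup : Subgroup (Equiv.Perm D.Dart) :=
  Subgroup.closure {D.glue, Equiv.prodShear (Equiv.refl D.V) (fun v => (D.kind v).arc)}

/-- The two ends of edges belong to the same arc of the diagram between crossings. -/
def SameArc (d e : D.Dart) : Prop := e ∈ MulAction.orbit D.arcGroup d

/-- The number of components of the diagram without crossings. -/
def freeCircles : ℕ :=
  Set.ncard {O : Set D.Dart | (∃ d, O = MulAction.orbit D.arcGroup d) ∧
    ∀ e ∈ O, ¬ (D.kind e.1).IsCrossing}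

/-- Two planar diagrams which differ only by vertices that are not crossings and by the
numbering at the vertices: a bijection between the crossings, with a rotation at each of
them, respects over and under and the arcs between the crossings, and there are equally many
circles without crossings. -/
def Isotopic (D E : LinkDiagram) : Prop :=
  D.Planar ∧ E.Planar ∧ D.freeCircles = E.freeCircles ∧
  ∃ f : (D.Cr × Fin 4) ≃ (E.Cr × Fin 4),
    (∀ d, f (rot D.Cr d) = rot E.Cr (f d)) ∧
    (∀ d, (D.kind d.1.1).isOver d.2 = (E.kind (f d).1.1).isOver (f d).2) ∧
    (∀ d e, D.SameArc (d.1.1, d.2) (e.1.1, e.2) ↔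
      E.SameArc ((f d).1.1, (f d).2) ((f e).1.1, (f e).2))

/-- Moving each of the three strands of a triangle with vertices `v k` across the opposite
vertex. The strand through `v k` and `v (k + 1)` enters `v k` at its end `i k + 2`, leaves it at
`i k`, enters `v (k + 1)` at `i (k + 1) + 1` and leaves it at `i (k + 1) + 3`; after the move it
passes, in the same direction, through `v (k + 1)` first. -/
def triangleSwap (v : Fin 3 → D.V) (i : Fin 3 → Fin 4) : Equiv.Perm D.Dart :=
  let σ : Fin 3 → Equiv.Perm D.Dart := fun k =>
    Equiv.swap (v k, i k + 2) (v (k + 1), i (k + 1) + 1) *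
      Equiv.swap (v k, i k) (v (k + 1), i (k + 1) + 3)
  σ 0 * σ 1 * σ 2

/-- Planar isotopies and Reidemeister moves. A face with the corners `(v k, i k, i k + 1)`,
in counterclockwise order, is given by `glue (v k, i k) = (v (k + 1), i (k + 1) + 1)`. -/
inductive Move : LinkDiagram → LinkDiagram → Prop
  | isotopy {D E : LinkDiagram} (h : Isotopic D E) : Move D E
  /-- A crossing with a monogon is replaced by an uncrossed arc. -/
  | r1 {D : LinkDiagram} (hD : D.Planar) (v : D.V) (i : Fin 4) (s : Smoothing)
      (hv : (D.kind v).IsCrossing) (hface : D.glue (v, i) = (v, i + 1))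
      (hs : s.arc i = i + 3) : Move D (D.smooth v s)
  /-- Two crossings with a bigon, one side of which is over at both ends (or under at
  both ends), are replaced by two uncrossed arcs. -/
  | r2 {D : LinkDiagram} (hD : D.Planar) (v w : D.V) (i j : Fin 4) (s t : Smoothing)
      (hvw : v ≠ w) (hv : (D.kind v).IsCrossing) (hw : (D.kind w).IsCrossing)
      (hface₁ : D.glue (v, i) = (w, j + 1)) (hface₂ : D.glue (w, j) = (v, i + 1))
      (hover : (D.kind v).isOver i = (D.kind w).isOver (j + 1))
      (hs : s.arc i = i + 3) (ht : t.arc j = j + 3) :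
      Move D ((D.smooth v s).smooth w t)
  /-- The three strands of a triangle, one of which is over both others, are moved across. -/
  | r3 {D : LinkDiagram} (hD : D.Planar) (v : Fin 3 → D.V) (i : Fin 3 → Fin 4)
      (hinj : Function.Injective v) (hv : ∀ k, (D.kind (v k)).IsCrossing)
      (hface : ∀ k, D.glue (v k, i k) = (v (k + 1), i (k + 1) + 1))
      (htop₁ : (D.kind (v 0)).isOver (i 0) = true)
      (htop₂ : (D.kind (v 1)).isOver (i 1 + 1) = true) :
      Move D (D.reattach (D.triangleSwap v i))

/-- The diagrams represent the same link. -/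
def SameLink : LinkDiagram → LinkDiagram → Prop := Relation.EqvGen Move

/-- A circle. -/
def circle : LinkDiagram where
  V := Unit
  glue := Equiv.prodCongr (Equiv.refl Unit) (Equiv.subLeft 1)
  glue_glue := by decide
  glue_ne := by decide
  kind := fun _ => .smoothed .zero

/-- The diagram represents a quasi-alternating link: the smallest class of links which contains
the unknot, and contains the link of a diagram `D` as soon as, for some crossing `c` of `D`, it
contains the links of both smoothings of `D` at `c` and `det D` is the sum of their
determinants. -/
inductive QuasiAlternating : LinkDiagram → Prop
  | unknot : QuasiAlternating circle
  | sameLink {D E : LinkDiagram} (h : SameLink D E) (hD : QuasiAlternating D) :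
      QuasiAlternating E
  | step {D : LinkDiagram} (hD : D.Planar) (c : D.V) (hc : (D.kind c).IsCrossing)
      (h₀ : QuasiAlternating (D.smooth c .zero)) (h₁ : QuasiAlternating (D.smooth c .infty))
      (hdet : D.det = (D.smooth c .zero).det + (D.smooth c .infty).det) : QuasiAlternating D

/-! ### Rational extensions -/

/-- The directions of tangle addition: side by side, and one above the other. -/
inductive Direction : Type
  | horizontal
  | vertical

def Direction.other : Direction → Direction
  | .horizontal => .vertical
  | .vertical => .horizontal

/-- Add a separate component with a single vertex, called `none`, of kind `k`, whose
four ends are glued like the arcs of `s`. -/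
def addVertex (s : Smoothing) (k : Elementary) : LinkDiagram where
  V := Option D.V
  glue := Function.Involutive.toPerm
    (fun d : Option D.V × Fin 4 =>
      match d with
      | (some v, i) => (some (D.glue (v, i)).1, (D.glue (v, i)).2)
      | (none, i) => (none, s.arc i))
    (by
      rintro ⟨_ | v, i⟩
      · simp [s.arc_arc]
      · simp [D.glue_glue])
  glue_glue := by
    rintro ⟨_ | v, i⟩
    · simp [Function.Involutive.toPerm, s.arc_arc]
    · simp [Function.Involutive.toPerm, D.glue_glue]
  glue_ne := by
    rintro ⟨_ | v, i⟩
    · simpa [Function.Involutive.toPerm] using s.arc_ne i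
    · have h := D.glue_ne (v, i)
      simpa [Function.Involutive.toPerm, Prod.ext_iff] using h
  kind := fun v => v.elim k D.kind

/-- Replace the tangle `t` at the vertex `c` by `t + ε` (horizontal) or by `t * ε` (vertical),
where `ε` is a new crossing, called `none`, of the same kind as `c`. Horizontally, the new crossing
is on the right: its ends `0, 1` (`NW, SW`) are joined to the ends `3, 2` (`NE, SE`) of `c`,
and its ends `3, 2` take the place of the ends `3, 2` of `c`. Vertically, the new crossing is at
the bottom: its ends `0, 3` (`NW, NE`) are joined to the ends `1, 2` (`SW, SE`) of `c`, and its
ends `1, 2` take the place of the ends `1, 2` of `c`. -/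
def twist (c : D.V) : Direction → LinkDiagram
  | .horizontal => (D.addVertex .zero (D.kind c)).reattach
      (Equiv.swap ((some c : Option D.V), (3 : Fin 4)) (none, 3) *
        Equiv.swap ((some c : Option D.V), (2 : Fin 4)) (none, 2))
  | .vertical => (D.addVertex .infty (D.kind c)).reattach
      (Equiv.swap ((some c : Option D.V), (1 : Fin 4)) (none, 1) *
        Equiv.swap ((some c : Option D.V), (2 : Fin 4)) (none, 2))

/-- The crossing `c` that remains after `twist`, at the left or at the top. -/
def oldCrossing (c : D.V) : (r : Direction) → (D.twist c r).V
  | .horizontal => (some c : Option D.V)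
  | .vertical => (some c : Option D.V)

/-- The crossing that is added by `twist`, at the right or at the bottom. -/
def newCrossing (c : D.V) : (r : Direction) → (D.twist c r).V
  | .horizontal => (none : Option D.V)
  | .vertical => (none : Option D.V)

/-- One twist at the marked crossing, which remains marked. -/
def twistStep (r : Direction) (p : Σ D : LinkDiagram, D.V) : Σ D : LinkDiagram, D.V :=
  ⟨p.1.twist p.2 r, p.1.oldCrossing p.2 r⟩

/-- Replace the marked crossing, of sign `ε`, by the standard diagram of the rational tangle
`[ε a₁, ε a₂, ..., ε aₙ]`, that is `ε (a₁ + 1 / (a₂ + 1 / (... + 1 / aₙ)))`. It is built from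
the outside: `a₁` crossings in the direction `r`, then `a₂` crossings in the other direction, and
so on; the marked crossing is the innermost of the last `aₙ` crossings. -/
def insertTangle : Direction → List ℕ → (Σ D : LinkDiagram, D.V) → Σ D : LinkDiagram, D.V
  | _, [], p => p
  | r, [a], p => (twistStep r)^[a - 1] p
  | r, a :: b :: l, p => insertTangle r.other (b :: l) ((twistStep r)^[a] p)

/-- The rational extension of `D` at the crossing `c` with the tangle `[ε a₁, ..., ε aₙ]`, where
`ε` is the sign of `c`. -/
def rationalExtension (c : D.V) (a : List ℕ) : LinkDiagram :=
  (insertTangle .horizontal a ⟨D, c⟩).1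

/-- `[ε a₁, ..., ε aₙ]` extends a crossing of sign `ε`: all `aᵢ` are positive, except that `a₁`
may be `0` when `n ≥ 2` (so that `ε/2 = [0, 2ε]` is allowed). -/
def IsExtensionTuple (a : List ℕ) : Prop :=
  a ≠ [] ∧ a ≠ [0] ∧ ∀ x ∈ a.tail, 1 ≤ x

/-- For a crossing `c` of sign `ε`, the diagram `D.twist c .horizontal` is the rational
extension with `[2ε]`, the diagram `D.twist c .vertical` the one with `[0, 2ε] = ε/2`. -/
theorem rationalExtension_two (c : D.V) :
    D.rationalExtension c [2] = D.twist c .horizontal := rfl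

theorem rationalExtension_zero_two (c : D.V) :
    D.rationalExtension c [0, 2] = D.twist c .vertical := rfl

end LinkDiagram

end

/-
At the root of unity `A` with `A ^ 2 = i` the value `-A² - A⁻²` of a loop vanishes, so only the
states with a single circle contribute to the Kauffman bracket, whose absolute value is the
determinant. In an alternating planar diagram, colour the faces like a checkerboard. A state merges
two faces of one colour at each crossing, the colour being decided by whether its weight there is
`A` or `A⁻¹`; if the state is a single circle, then all faces of a colour are merged into one, and
Euler's formula leaves no room for a redundant merger. Hence the number of weights `A` is the number
of faces of one colour minus one, all these states have the same weight, and the determinant is the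
sum of the determinants of the two smoothings at any crossing.

Changing a crossing inverts its two weights `A` and `A⁻¹`, whose squares are `i` and `-i`. So at a
dealternator `c` the two contributions have opposite phases and `det D` is the absolute value of the
difference of the determinants of the smoothings. A twist at `c` yields a diagram whose smoothings
at each of the two crossings have, up to phase, the brackets of `D` and of one of the smoothings
of `D`; if this is the smoothing with the larger determinant, the phases agree again. From then on
each new crossing adds to the determinant that of a smoothing, which is at least one because
`1 ≤ c(D) ≤ det D`.
-/

noncomputable section

open Finset Function

section Orbits

variable {α : Type} (S : Set (Equiv.Perm α))

theorem numOrbits_eq_card_quot :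
    numOrbits S = Nat.card (Quot fun x y : α => ∃ g ∈ S, g x = y) := by
  have mk_apply : ∀ g ∈ Subgroup.closure S, ∀ x,
      Quot.mk (fun x y : α => ∃ g ∈ S, g x = y) (g x) = Quot.mk _ x := by
    intro g hg
    induction hg using Subgroup.closure_induction with
    | mem g hg => exact fun x => (Quot.sound ⟨g, hg, rfl⟩).symm
    | one => exact fun x => rfl
    | mul g h _ _ ihg ihh => exact fun x => (ihg (h x)).trans (ihh x)
    | inv g _ ih => exact fun x => by simpa using (ih (g⁻¹ x)).symm
  refine Nat.card_congr
    { toFun := Quotient.lift (Quot.mk _) ?_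
      invFun := Quot.lift (Quotient.mk _) ?_
      left_inv := by rintro ⟨x⟩; rfl
      right_inv := by rintro ⟨x⟩; rfl }
  · rintro _ x ⟨g, rfl⟩
    exact mk_apply g g.2 x
  · rintro x _ ⟨g, hg, rfl⟩
    exact (Quotient.sound ⟨⟨g, Subgroup.subset_closure hg⟩, rfl⟩ :
      (⟦g x⟧ : MulAction.orbitRel.Quotient (Subgroup.closure S) α) = ⟦x⟧).symm

theorem numOrbits_pos [Finite α] [Nonempty α] : 0 < numOrbits S := by
  have : Nonempty (Quot fun x y : α => ∃ g ∈ S, g x = y) := .map (Quot.mk _) ‹_›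
  rw [numOrbits_eq_card_quot]
  exact Nat.card_pos

variable (K : Type*) [Field K]

/-- The functions on `α` with values in `K` which are invariant under the permutations in `S`.
The orbits of `S` are counted as the dimension of this space. -/
def invariantFunctions : Submodule K (α → K) where
  carrier := {f | ∀ g ∈ S, ∀ x, f (g x) = f x}
  add_mem' hf hg σ hσ x := by simp only [Pi.add_apply, hf σ hσ x, hg σ hσ x]
  zero_mem' _ _ _ := rfl
  smul_mem' a f hf σ hσ x := by simp only [Pi.smul_apply, hf σ hσ x]

theorem range_funLeft_quot_mk : LinearMap.range
    (LinearMap.funLeft K K (Quot.mk fun x y : α => ∃ g ∈ S, g x = y)) =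
      invariantFunctions S K := by
  ext f
  constructor
  · rintro ⟨h, rfl⟩ g hg x
    exact congrArg h (Quot.sound ⟨g, hg, rfl⟩).symm
  · intro hf
    refine ⟨Quot.lift f ?_, rfl⟩
    rintro x _ ⟨g, hg, rfl⟩
    exact (hf g hg x).symm

theorem finrank_invariantFunctions [Finite α] :
    Module.finrank K (invariantFunctions S K) = numOrbits S := by
  have := Fintype.ofFinite (Quot fun x y : α => ∃ g ∈ S, g x = y)
  rw [← range_funLeft_quot_mk, LinearMap.finrank_range_of_inj
    (LinearMap.funLeft_injective_of_surjective _ _ _ Quot.mk_surjective),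
    Module.finrank_fintype_fun_eq_card, numOrbits_eq_card_quot, Nat.card_eq_fintype_card]

end Orbits

theorem finrank_le_finrank_add_card {K E ι : Type*} [Field K] [AddCommGroup E]
    [Module K E] [FiniteDimensional K E] {P Q : Submodule K E} (I : Finset ι)
    (l : ι → Module.Dual K E) (h : ∀ f ∈ P, (∀ i ∈ I, l i f = 0) → f ∈ Q) :
    Module.finrank K P ≤ Module.finrank K Q + I.card := by
  let L : P →ₗ[K] (I → K) := LinearMap.pi fun i => (l i).comp P.subtype
  have rank_nullity := L.finrank_range_add_finrank_ker
  have range_le : Module.finrank K (LinearMap.range L) ≤ I.card := by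
    simpa using Submodule.finrank_le (LinearMap.range L)
  have ker_le : Module.finrank K (LinearMap.ker L) ≤ Module.finrank K Q := by
    rw [← LinearMap.finrank_range_of_inj (f := P.subtype.comp (LinearMap.ker L).subtype)
      (P.subtype_injective.comp (LinearMap.ker L).subtype_injective)]
    apply Submodule.finrank_mono
    rintro _ ⟨f, rfl⟩
    exact h _ f.1.2 fun i hi => congrFun (LinearMap.mem_ker.1 f.2) ⟨i, hi⟩
  omega

instance : Nontrivial Smoothing := ⟨.zero, .infty, nofun⟩

theorem Smoothing.eq_of_ne_of_ne {a b t : Smoothing} (ha : a ≠ t) (hb : b ≠ t) : a = b := by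
  decide +revert

namespace LinkDiagram

section Circle

variable (D : LinkDiagram) (s : D.V → Smoothing)

/-- The circles of the state `s`, as the classes of the ends of edges that they connect. -/
def Circle : Type :=
  Quot fun d e : D.Dart =>
    ∃ g ∈ ({D.glue, Equiv.prodShear (Equiv.refl D.V) fun v => (s v).arc} : Set (Equiv.Perm D.Dart)),
      g d = e

instance : Finite (D.Circle s) := inferInstanceAs (Finite (Quot _))

theorem circlesOfState_eq_card : D.circlesOfState s = Nat.card (D.Circle s) :=
  numOrbits_eq_card_quot _

theorem circlesOfState_pos [Nonempty D.V] : 0 < D.circlesOfState s :=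
  numOrbits_pos _

namespace Circle

variable {D s}

/-- The circle through an end of an edge. -/
def mk (d : D.Dart) : D.Circle s := Quot.mk _ d

theorem mk_glue (d : D.Dart) : (mk (D.glue d) : D.Circle s) = mk d :=
  (Quot.sound ⟨D.glue, .inl rfl, rfl⟩).symm

theorem mk_arc (v : D.V) (i : Fin 4) : (mk (v, (s v).arc i) : D.Circle s) = mk (v, i) :=
  (Quot.sound ⟨_, .inr rfl, rfl⟩).symm

/-- A function on the ends of edges which is constant along the circles of a state. -/
def lift {β : Type*} (f : D.Dart → β) (hglue : ∀ d, f (D.glue d) = f d)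
    (harc : ∀ v i, f (v, (s v).arc i) = f (v, i)) : D.Circle s → β :=
  Quot.lift f <| by
    rintro d _ ⟨g, rfl | rfl, rfl⟩
    exacts [(hglue d).symm, (harc d.1 d.2).symm]

theorem ind {P : D.Circle s → Prop} (h : ∀ d, P (mk d)) (q : D.Circle s) : P q :=
  Quot.ind h q

end Circle

theorem apply_eq_apply_of_circlesOfState_le_one {D : LinkDiagram} {s : D.V → Smoothing}
    (hs : D.circlesOfState s ≤ 1) {β : Type*} {f : D.Dart → β} (hglue : ∀ d, f (D.glue d) = f d)
    (harc : ∀ v i, f (v, (s v).arc i) = f (v, i)) (d e : D.Dart) : f d = f e := by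
  rw [circlesOfState_eq_card, Finite.card_le_one_iff_subsingleton] at hs
  exact congrArg (Circle.lift f hglue harc) (Subsingleton.elim (Circle.mk d) (Circle.mk e))

end Circle

namespace Direction

/-- The smoothing with the arcs along which a new crossing is joined to the old one. -/
def joint : Direction → Smoothing
  | .horizontal => .zero
  | .vertical => .infty

/-- The two ends at which a new crossing takes the place of the old one. -/
def movedEnds (r : Direction) : Finset (Fin 4) := {2, r.joint.arc 0}

theorem joint_arc_mem_movedEnds {r : Direction} {i : Fin 4} :
    r.joint.arc i ∈ r.movedEnds ↔ i ∉ r.movedEnds := by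
  revert i; cases r <;> decide

/-- The sum of two smoothings in a direction, without the circle it may contain. -/
def add (r : Direction) (a b : Smoothing) : Smoothing := if b = r.joint then a else b

/-- The sum of the two smoothings in a direction contains a circle. -/
def ClosesCircle (r : Direction) (a b : Smoothing) : Prop := a ≠ r.joint ∧ b ≠ r.joint

instance (r : Direction) (a b : Smoothing) : Decidable (r.ClosesCircle a b) :=
  inferInstanceAs (Decidable (_ ∧ _))

/-- The end of the sum of the smoothings `a` and `b` which is connected to the end `i` of the
first summand, if there is one. -/
def oldEnd (r : Direction) (a b : Smoothing) (i : Fin 4) : Option (Fin 4) :=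
  if i ∉ r.movedEnds ∨ b = r.joint then some i
  else if a = r.joint then some (r.joint.arc i)
  else none

/-- The end of the sum of the smoothings `a` and `b` which is connected to the end `i` of the
second summand, if there is one. -/
def newEnd (r : Direction) (a b : Smoothing) (i : Fin 4) : Option (Fin 4) :=
  if i ∈ r.movedEnds then some i else r.oldEnd a b (r.joint.arc i)

theorem oldEnd_arc (r : Direction) (a b : Smoothing) (i : Fin 4) :
    r.oldEnd a b (a.arc i) = r.oldEnd a b i ∨
      r.oldEnd a b (a.arc i) = (r.oldEnd a b i).map (r.add a b).arc := by
  revert i; cases r <;> cases a <;> cases b <;> decide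

theorem newEnd_arc (r : Direction) (a b : Smoothing) (i : Fin 4) :
    r.newEnd a b (b.arc i) = r.newEnd a b i ∨
      r.newEnd a b (b.arc i) = (r.newEnd a b i).map (r.add a b).arc := by
  revert i; cases r <;> cases a <;> cases b <;> decide

end Direction

section Twisted

variable (D : LinkDiagram) (c : D.V) (r : Direction)

/-- The permutation of the ends of edges by which a new crossing takes the place of `c` at the
moved ends. -/
def moveEnds : Equiv.Perm (Option D.V × Fin 4) :=
  Equiv.swap (some c, r.joint.arc 0) (none, r.joint.arc 0) * Equiv.swap (some c, 2) (none, 2)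

/-- The diagram `D.twist c r`, written uniformly in `r`, so that its vertices are known to be
`Option D.V` for a variable direction. -/
def twisted : LinkDiagram :=
  (D.addVertex r.joint (D.kind c)).reattach (D.moveEnds c r)

/-- The vertex `v` of `D`, in `D.twisted c r`; for `v = c` it is the first of the two crossings. -/
def oldVertex (v : D.V) : (D.twisted c r).V := (some v : Option D.V)

/-- The crossing that is added in `D.twisted c r`. -/
def newVertex : (D.twisted c r).V := (none : Option D.V)

/-- The end of an edge of `D`, as an end of an edge of `D.twisted c r`. -/
def outerDart (d : D.Dart) : (D.twisted c r).Dart :=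
  if d.1 = c ∧ d.2 ∈ r.movedEnds then (D.newVertex c r, d.2) else (D.oldVertex c r d.1, d.2)

variable {c r}

@[elab_as_elim]
theorem twisted_vertex_cases {P : (D.twisted c r).V → Prop} (new : P (D.newVertex c r))
    (old : ∀ v, P (D.oldVertex c r v)) : ∀ x, P x
  | none => new
  | some v => old v

theorem outerDart_of_mem {i : Fin 4} (hi : i ∈ r.movedEnds) :
    D.outerDart c r (c, i) = (D.newVertex c r, i) := if_pos ⟨rfl, hi⟩

theorem outerDart_of_notMem {i : Fin 4} (hi : i ∉ r.movedEnds) :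
    D.outerDart c r (c, i) = (D.oldVertex c r c, i) := if_neg fun h => hi h.2

theorem outerDart_of_ne {v : D.V} (hv : v ≠ c) (i : Fin 4) :
    D.outerDart c r (v, i) = (D.oldVertex c r v, i) := if_neg fun h => hv h.1

variable (c r)

theorem moveEnds_none (i : Fin 4) :
    D.moveEnds c r (none, i) = (if i ∈ r.movedEnds then some c else none, i) := by
  cases r <;> fin_cases i <;>
    simp [moveEnds, Equiv.swap_apply_def, Direction.movedEnds, Direction.joint, Smoothing.arc]

theorem moveEnds_some_self (i : Fin 4) :
    D.moveEnds c r (some c, i) = (if i ∈ r.movedEnds then none else some c, i) := by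
  cases r <;> fin_cases i <;>
    simp [moveEnds, Equiv.swap_apply_def, Direction.movedEnds, Direction.joint, Smoothing.arc]

theorem moveEnds_some (d : D.Dart) : D.moveEnds c r (some d.1, d.2) = D.outerDart c r d := by
  obtain ⟨v, i⟩ := d
  by_cases hv : v = c
  · subst hv
    rw [moveEnds_some_self]
    by_cases hi : i ∈ r.movedEnds
    · rw [outerDart_of_mem D hi, if_pos hi]
      rfl
    · rw [outerDart_of_notMem D hi, if_neg hi]
      rfl
  · have ne_some (j : Fin 4) : ((some v, i) : Option D.V × Fin 4) ≠ (some c, j) :=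
      fun h => hv (Option.some_injective _ (Prod.ext_iff.1 h).1)
    have ne_none (j : Fin 4) : ((some v, i) : Option D.V × Fin 4) ≠ (none, j) := nofun
    rw [outerDart_of_ne D hv, moveEnds, Equiv.Perm.mul_apply,
      Equiv.swap_apply_of_ne_of_ne (ne_some 2) (ne_none 2),
      Equiv.swap_apply_of_ne_of_ne (ne_some _) (ne_none _)]
    rfl

theorem twisted_glue_moveEnds (d : Option D.V × Fin 4) :
    (D.twisted c r).glue (D.moveEnds c r d) =
      D.moveEnds c r ((D.addVertex r.joint (D.kind c)).glue d) :=
  congrArg (fun e => D.moveEnds c r ((D.addVertex r.joint (D.kind c)).glue e))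
    ((D.moveEnds c r).symm_apply_apply d)

variable {c r}

theorem twisted_glue_outerDart (d : D.Dart) :
    (D.twisted c r).glue (D.outerDart c r d) = D.outerDart c r (D.glue d) := by
  rw [← moveEnds_some, ← moveEnds_some]
  exact twisted_glue_moveEnds D c r (some d.1, d.2)

theorem twisted_glue_newVertex {i : Fin 4} (hi : i ∉ r.movedEnds) :
    (D.twisted c r).glue (D.newVertex c r, i) = (D.oldVertex c r c, r.joint.arc i) := by
  have h : (D.twisted c r).glue (D.moveEnds c r (none, i)) = D.moveEnds c r (none, r.joint.arc i) :=
    D.twisted_glue_moveEnds c r (none, i)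
  rwa [moveEnds_none, moveEnds_none, if_neg hi,
    if_pos (Direction.joint_arc_mem_movedEnds.2 hi)] at h

theorem twisted_glue_oldVertex {i : Fin 4} (hi : i ∈ r.movedEnds) :
    (D.twisted c r).glue (D.oldVertex c r c, i) = (D.newVertex c r, r.joint.arc i) := by
  have harc : r.joint.arc i ∉ r.movedEnds := by
    rwa [Direction.joint_arc_mem_movedEnds, not_not]
  have h := twisted_glue_newVertex D (c := c) harc
  rw [Smoothing.arc_arc] at h
  rw [← h, glue_glue]

end Twisted

namespace Direction

theorem oldEnd_of_notMem {r : Direction} {i : Fin 4} (hi : i ∉ r.movedEnds) (a b : Smoothing) :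
    r.oldEnd a b i = some i := if_pos (.inl hi)

theorem newEnd_of_mem {r : Direction} {i : Fin 4} (hi : i ∈ r.movedEnds) (a b : Smoothing) :
    r.newEnd a b i = some i := if_pos hi

theorem newEnd_of_notMem {r : Direction} {i : Fin 4} (hi : i ∉ r.movedEnds) (a b : Smoothing) :
    r.newEnd a b i = r.oldEnd a b (r.joint.arc i) := if_neg hi

theorem oldEnd_eq_none_iff {r : Direction} {a b : Smoothing} {i : Fin 4} :
    r.oldEnd a b i = none ↔ r.ClosesCircle a b ∧ (i = 2 ∨ i = a.arc 2) := by
  revert i; cases r <;> cases a <;> cases b <;> decide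

theorem oldEnd_eq_some {r : Direction} {a b : Smoothing} {i j : Fin 4}
    (h : r.oldEnd a b i = some j) : j = i ∧ (i ∈ r.movedEnds → b = r.joint) ∨
      j = r.joint.arc i ∧ a = r.joint ∧ i ∈ r.movedEnds := by
  revert i j; cases r <;> cases a <;> cases b <;> decide

theorem add_joint (r : Direction) (a : Smoothing) : r.add a r.joint = a := if_pos rfl

theorem add_of_ne {r : Direction} {b : Smoothing} (hb : b ≠ r.joint) (a : Smoothing) :
    r.add a b = b := if_neg hb

theorem arc_mem_movedEnds {r : Direction} {a : Smoothing} (ha : a ≠ r.joint) {i : Fin 4} :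
    a.arc i ∈ r.movedEnds ↔ i ∈ r.movedEnds := by
  revert i; cases r <;> cases a <;> first | decide | exact absurd rfl ha

end Direction

section TwistedCircles

variable {D : LinkDiagram} {c : D.V} {r : Direction}

theorem twisted_dart_induction {P : (D.twisted c r).Dart → Prop}
    (outer : ∀ d, P (D.outerDart c r d))
    (inner : ∀ i ∈ r.movedEnds, P (D.oldVertex c r c, i))
    (glue : ∀ d, P d → P ((D.twisted c r).glue d)) : ∀ d, P d := by
  rintro ⟨x, i⟩
  induction x using twisted_vertex_cases with
  | new =>
    by_cases hi : i ∈ r.movedEnds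
    · rw [← outerDart_of_mem D hi]
      exact outer _
    · have h := glue _ (inner _ (Direction.joint_arc_mem_movedEnds.2 hi))
      rwa [← twisted_glue_newVertex D hi, glue_glue] at h
  | old v =>
    by_cases hv : v = c
    · subst hv
      by_cases hi : i ∈ r.movedEnds
      · exact inner i hi
      · rw [← outerDart_of_notMem D hi]
        exact outer _
    · rw [← outerDart_of_ne D hv]
      exact outer _

/-- The state of `D` with the sum of the smoothings of the two crossings in the place of `c`. -/
def mergedState (s : (D.twisted c r).V → Smoothing) : D.V → Smoothing :=
  update (s ∘ D.oldVertex c r) c (r.add (s (D.oldVertex c r c)) (s (D.newVertex c r)))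

variable {s : (D.twisted c r).V → Smoothing}

theorem mergedState_self : mergedState s c = r.add (s (D.oldVertex c r c)) (s (D.newVertex c r)) :=
  update_self ..

theorem mergedState_of_ne {v : D.V} (hv : v ≠ c) : mergedState s v = s (D.oldVertex c r v) :=
  update_of_ne hv ..

namespace Circle

variable (s) in
/-- The circle of the merged state through an end of an edge of the twisted diagram; `none` for
the circle which lies between the two crossings. -/
def innerMk : (D.twisted c r).Dart → Option (D.Circle (mergedState s))
  | (none, i) => (r.newEnd (s (D.oldVertex c r c)) (s (D.newVertex c r)) i).map fun j => mk (c, j)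
  | (some v, i) =>
    if v = c then
      (r.oldEnd (s (D.oldVertex c r c)) (s (D.newVertex c r)) i).map fun j => mk (c, j)
    else some (mk (v, i))

theorem innerMk_newVertex (i : Fin 4) : innerMk s (D.newVertex c r, i) =
    (r.newEnd (s (D.oldVertex c r c)) (s (D.newVertex c r)) i).map fun j => mk (c, j) := rfl

theorem innerMk_oldVertex_self (i : Fin 4) : innerMk s (D.oldVertex c r c, i) =
    (r.oldEnd (s (D.oldVertex c r c)) (s (D.newVertex c r)) i).map fun j => mk (c, j) := if_pos rfl

theorem innerMk_oldVertex_of_ne {v : D.V} (hv : v ≠ c) (i : Fin 4) :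
    innerMk s (D.oldVertex c r v, i) = some (mk (v, i)) := if_neg hv

theorem innerMk_outerDart (d : D.Dart) : innerMk s (D.outerDart c r d) = some (mk d) := by
  obtain ⟨v, i⟩ := d
  by_cases hv : v = c
  · subst hv
    by_cases hi : i ∈ r.movedEnds
    · rw [outerDart_of_mem D hi, innerMk_newVertex, Direction.newEnd_of_mem hi, Option.map_some]
    · rw [outerDart_of_notMem D hi, innerMk_oldVertex_self, Direction.oldEnd_of_notMem hi,
        Option.map_some]
  · rw [outerDart_of_ne D hv, innerMk_oldVertex_of_ne hv]

theorem innerMk_glue (d : (D.twisted c r).Dart) :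
    innerMk s ((D.twisted c r).glue d) = innerMk s d := by
  induction d using twisted_dart_induction with
  | outer d => rw [twisted_glue_outerDart, innerMk_outerDart, innerMk_outerDart, mk_glue]
  | inner i hi =>
    have harc : r.joint.arc i ∉ r.movedEnds := by
      rwa [Direction.joint_arc_mem_movedEnds, not_not]
    rw [twisted_glue_oldVertex D hi, innerMk_newVertex, innerMk_oldVertex_self,
      Direction.newEnd_of_notMem harc, Smoothing.arc_arc]
  | glue d hd => rw [glue_glue, hd]

theorem map_mk_eq_map_mk {p q : Option (Fin 4)} (v : D.V) (t : D.V → Smoothing)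
    (h : p = q ∨ p = q.map (t v).arc) :
    p.map (fun j => (mk (v, j) : D.Circle t)) = q.map fun j => mk (v, j) := by
  obtain rfl | rfl := h
  · rfl
  · rw [Option.map_map]
    exact congrArg q.map (funext fun j => mk_arc v j)

theorem innerMk_arc (x : (D.twisted c r).V) (i : Fin 4) :
    innerMk s (x, (s x).arc i) = innerMk s (x, i) := by
  induction x using twisted_vertex_cases with
  | new =>
    apply map_mk_eq_map_mk
    rw [mergedState_self]
    exact Direction.newEnd_arc ..
  | old v =>
    by_cases hv : v = c
    · subst hv
      rw [innerMk_oldVertex_self, innerMk_oldVertex_self]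
      apply map_mk_eq_map_mk
      rw [mergedState_self]
      exact Direction.oldEnd_arc ..
    · rw [innerMk_oldVertex_of_ne hv, innerMk_oldVertex_of_ne hv,
        ← mergedState_of_ne (s := s) hv, mk_arc]

variable (s) in
/-- The circle of the merged state which is a given circle of the twisted diagram, if it is not
the circle between the two crossings. -/
def untwist : Circle (D.twisted c r) s → Option (D.Circle (mergedState s)) :=
  lift (innerMk s) innerMk_glue innerMk_arc

theorem untwist_mk (d : (D.twisted c r).Dart) : untwist s (mk d) = innerMk s d := rfl

theorem mk_newVertex_of_notMem {i : Fin 4} (hi : i ∉ r.movedEnds) :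
    (mk (D.newVertex c r, i) : Circle _ s) = mk (D.oldVertex c r c, r.joint.arc i) := by
  rw [← mk_glue, twisted_glue_newVertex D hi]

theorem mk_oldVertex_of_mem {i : Fin 4} (hi : i ∈ r.movedEnds) :
    (mk (D.oldVertex c r c, i) : Circle _ s) = mk (D.newVertex c r, r.joint.arc i) := by
  rw [← mk_glue, twisted_glue_oldVertex D hi]

theorem mk_oldVertex_of_joint (hs : s (D.newVertex c r) = r.joint) (i : Fin 4) :
    (mk (D.oldVertex c r c, i) : Circle _ s) = mk (D.outerDart c r (c, i)) := by
  by_cases hi : i ∈ r.movedEnds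
  · rw [outerDart_of_mem D hi, mk_oldVertex_of_mem hi, ← hs, mk_arc]
  · rw [outerDart_of_notMem D hi]

theorem mk_outerDart_arc (v : D.V) (i : Fin 4) :
    (mk (D.outerDart c r (v, (mergedState s v).arc i)) : Circle _ s) =
      mk (D.outerDart c r (v, i)) := by
  by_cases hv : v = c
  · subst hv
    rw [mergedState_self]
    by_cases hnew : s (D.newVertex v r) = r.joint
    · rw [hnew, Direction.add_joint, ← mk_oldVertex_of_joint hnew, ← mk_oldVertex_of_joint hnew,
        mk_arc]
    rw [Direction.add_of_ne hnew]
    have harc := Direction.arc_mem_movedEnds hnew (i := i)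
    by_cases hi : i ∈ r.movedEnds
    · rw [outerDart_of_mem D hi, outerDart_of_mem D (harc.2 hi), mk_arc]
    rw [outerDart_of_notMem D hi, outerDart_of_notMem D (harc.not.2 hi)]
    by_cases hold : s (D.oldVertex v r v) = r.joint
    · have mk_old {j : Fin 4} (hj : j ∉ r.movedEnds) :
          (mk (D.oldVertex v r v, j) : Circle _ s) = mk (D.newVertex v r, j) := by
        rw [mk_newVertex_of_notMem hj, ← hold, mk_arc]
      rw [mk_old hi, mk_old (harc.not.2 hi), mk_arc]
    · rw [Smoothing.eq_of_ne_of_ne hnew hold, mk_arc]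
  · rw [outerDart_of_ne D hv, outerDart_of_ne D hv, mergedState_of_ne hv, mk_arc]

variable (s) in
/-- The circle of the twisted diagram which is a given circle of the merged state. -/
def twist : D.Circle (mergedState s) → Circle (D.twisted c r) s :=
  lift (fun d => mk (D.outerDart c r d))
    (fun d => by rw [← twisted_glue_outerDart, mk_glue]) mk_outerDart_arc

theorem twist_mk (d : D.Dart) : twist s (mk d) = mk (D.outerDart c r d) := rfl

theorem untwist_twist (q : D.Circle (mergedState s)) : untwist s (twist s q) = some q := by
  induction q using Circle.ind with
  | h d => exact innerMk_outerDart d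

theorem twist_of_untwist_eq_some {x : Circle (D.twisted c r) s} {q : D.Circle (mergedState s)}
    (h : untwist s x = some q) : twist s q = x := by
  induction x using Circle.ind with | h d => ?_
  rw [untwist_mk] at h
  induction d using twisted_dart_induction with
  | outer d =>
    rw [innerMk_outerDart, Option.some_inj] at h
    rw [← h, twist_mk]
  | inner i hi =>
    rw [innerMk_oldVertex_self, Option.map_eq_some_iff] at h
    obtain ⟨j, hj, rfl⟩ := h
    rw [twist_mk]
    obtain ⟨rfl, hnew⟩ | ⟨rfl, hold, hi⟩ := Direction.oldEnd_eq_some hj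
    · rw [mk_oldVertex_of_joint (hnew hi)]
    · rw [outerDart_of_notMem D (Direction.joint_arc_mem_movedEnds.not_left.2 hi), ← hold, mk_arc]
  | glue d hd =>
    rw [innerMk_glue] at h
    rw [mk_glue, hd h]

theorem eq_mk_of_untwist_eq_none {x : Circle (D.twisted c r) s} (h : untwist s x = none) :
    x = mk (D.oldVertex c r c, 2) := by
  induction x using Circle.ind with | h d => ?_
  rw [untwist_mk] at h
  induction d using twisted_dart_induction with
  | outer d => simp only [innerMk_outerDart, reduceCtorEq] at h
  | inner i hi =>
    rw [innerMk_oldVertex_self, Option.map_eq_none_iff, Direction.oldEnd_eq_none_iff] at h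
    obtain ⟨-, rfl | rfl⟩ := h
    · rfl
    · rw [mk_arc]
  | glue d hd =>
    rw [innerMk_glue] at h
    rw [mk_glue, hd h]

theorem untwist_mk_eq_none_iff :
    untwist s (mk (D.oldVertex c r c, 2)) = none ↔
      r.ClosesCircle (s (D.oldVertex c r c)) (s (D.newVertex c r)) := by
  rw [untwist_mk, innerMk_oldVertex_self, Option.map_eq_none_iff, Direction.oldEnd_eq_none_iff]
  simp only [true_or, and_true]

theorem untwist_injective : Injective (untwist (D := D) (c := c) (r := r) s) := by
  intro x y h
  cases hy : untwist s y with
  | none => rw [eq_mk_of_untwist_eq_none (h.trans hy), eq_mk_of_untwist_eq_none hy]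
  | some q => rw [← twist_of_untwist_eq_some (h.trans hy), twist_of_untwist_eq_some hy]

end Circle

theorem circlesOfState_twisted (s : (D.twisted c r).V → Smoothing) :
    (D.twisted c r).circlesOfState s = D.circlesOfState (mergedState s) +
      if r.ClosesCircle (s (D.oldVertex c r c)) (s (D.newVertex c r)) then 1 else 0 := by
  rw [circlesOfState_eq_card, circlesOfState_eq_card]
  split_ifs with h
  · rw [← Finite.card_option]
    refine Nat.card_eq_of_bijective _ ⟨Circle.untwist_injective, ?_⟩
    rintro (_ | q)
    exacts [⟨_, Circle.untwist_mk_eq_none_iff.2 h⟩, ⟨_, Circle.untwist_twist q⟩]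
  · refine (Nat.card_eq_of_bijective (Circle.twist s) ⟨?_, fun x => ?_⟩).symm
    · intro p q hpq
      rw [← Option.some_inj, ← Circle.untwist_twist p, ← Circle.untwist_twist q, hpq]
    · cases hx : Circle.untwist s x with
      | none =>
        rw [Circle.eq_mk_of_untwist_eq_none hx, Circle.untwist_mk_eq_none_iff] at hx
        exact absurd hx h
      | some q => exact ⟨q, Circle.twist_of_untwist_eq_some hx⟩

end TwistedCircles

end LinkDiagram

theorem sum_filter_update {V S M : Type*} [Fintype V] [DecidableEq V] [Fintype S] [DecidableEq S]
    [AddCommMonoid M] (f : (V → S) → M) (c : V) (a b : S) :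
    ∑ s with s c = a, f (update s c b) = ∑ s with s c = b, f s := by
  refine sum_nbij' (update · c b) (update · c a) ?_ ?_ ?_ ?_ fun _ _ => rfl
  all_goals simp +contextual

theorem sum_mul_update {V S R : Type*} [Fintype V] [DecidableEq V] [Fintype S] [DecidableEq S]
    [CommSemiring R] (f : (V → S) → R) (c : V) (g : S → R) (h : S → S) :
    ∑ s, g (s c) * f (update s c (h (s c))) = ∑ a, g a * ∑ s with s c = h a, f s := by
  rw [← sum_fiberwise univ fun s => s c]
  refine sum_congr rfl fun a _ => ?_
  rw [← sum_filter_update f c a, mul_sum]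
  refine sum_congr rfl fun s hs => ?_
  rw [(mem_filter.1 hs).2]

theorem Smoothing.sum_eq_add {M : Type*} [AddCommMonoid M] {a b : Smoothing} (h : a ≠ b)
    (f : Smoothing → M) : ∑ t, f t = f a + f b :=
  Fintype.sum_eq_add a b h fun _ ht => absurd (Smoothing.eq_of_ne_of_ne ht.1 h.symm) ht.2

theorem Smoothing.sum_univ {M : Type*} [AddCommMonoid M] (f : Smoothing → M) :
    ∑ t, f t = f .zero + f .infty :=
  Smoothing.sum_eq_add (by decide) f

namespace LinkDiagram

section StateSum

variable (D : LinkDiagram) {R : Type*} [CommSemiring R] (δ : R)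

/-- The state sum of a diagram with arbitrary weights of the smoothings at its vertices, where
every circle but one contributes `δ`. -/
def stateSum (w : D.V → Smoothing → R) : R :=
  ∑ s : D.V → Smoothing, (∏ v, w v (s v)) * δ ^ (D.circlesOfState s - 1)

variable {D}

/-- The contribution of a state to a state sum, without the weight of the smoothing at `c`. -/
def stateTermExcept (w : D.V → Smoothing → R) (c : D.V) (s : D.V → Smoothing) : R :=
  (∏ v ∈ univ.erase c, w v (s v)) * δ ^ (D.circlesOfState s - 1)

theorem prod_mul_pow_eq_mul_stateTermExcept (w : D.V → Smoothing → R) (c : D.V)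
    (s : D.V → Smoothing) :
    (∏ v, w v (s v)) * δ ^ (D.circlesOfState s - 1) = w c (s c) * stateTermExcept δ w c s := by
  rw [stateTermExcept, ← mul_prod_erase univ _ (mem_univ c), mul_assoc]

theorem stateTermExcept_update_weight (w : D.V → Smoothing → R) (c : D.V) (u : Smoothing → R) :
    stateTermExcept δ (update w c u) c = stateTermExcept δ w c := by
  funext s
  refine congrArg (· * _) (prod_congr rfl fun v hv => ?_)
  rw [update_of_ne (ne_of_mem_erase hv)]

theorem stateSum_update (w : D.V → Smoothing → R) (c : D.V) (u : Smoothing → R) :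
    D.stateSum δ (update w c u) = ∑ s, u (s c) * stateTermExcept δ w c s := by
  simp only [stateSum, prod_mul_pow_eq_mul_stateTermExcept δ _ c, update_self,
    stateTermExcept_update_weight]

theorem stateSum_update_eq_sum (w : D.V → Smoothing → R) (c : D.V) (u : Smoothing → R) :
    D.stateSum δ (update w c u) =
      ∑ t, u t * D.stateSum δ (update w c (Pi.single t 1)) := by
  simp only [stateSum_update, mul_sum]
  rw [sum_comm]
  refine sum_congr rfl fun s _ => ?_
  rw [Fintype.sum_eq_single (s c), Pi.single_eq_same, one_mul]
  intro t ht
  rw [Pi.single_eq_of_ne ht.symm, zero_mul, mul_zero]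

end StateSum

section Twisted

variable {R : Type*} [CommSemiring R] (δ : R)

/-- The weights of the sum of two tangles, with weights `u` and `u'`, in the direction `r`. -/
def Direction.addWeights (r : Direction) (u u' : Smoothing → R) (t : Smoothing) : R :=
  ∑ a, ∑ b, if r.add a b = t then u a * u' b * (if r.ClosesCircle a b then δ else 1) else 0

theorem Direction.add_comm (r : Direction) (a b : Smoothing) : r.add a b = r.add b a := by
  cases r <;> decide +revert

theorem Direction.closesCircle_comm (r : Direction) (a b : Smoothing) :
    r.ClosesCircle a b ↔ r.ClosesCircle b a := and_comm

theorem Direction.addWeights_comm (r : Direction) (u u' : Smoothing → R) :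
    r.addWeights δ u u' = r.addWeights δ u' u := by
  funext t
  rw [addWeights, sum_comm]
  refine sum_congr rfl fun a _ => sum_congr rfl fun b _ => ?_
  simp only [r.add_comm b a, r.closesCircle_comm b a, mul_comm (u b)]

variable {D : LinkDiagram} {c : D.V} {r : Direction}

/-- The state of the twisted diagram with the smoothing `b` at the new crossing. -/
def twistedState (b : Smoothing) (s : D.V → Smoothing) (x : (D.twisted c r).V) : Smoothing :=
  Option.elim x b s

theorem sum_twistedState {M : Type*} [AddCommMonoid M]
    (f : ((D.twisted c r).V → Smoothing) → M) :
    ∑ s, f s = ∑ b, ∑ s, f (twistedState b s) := by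
  rw [← Fintype.sum_prod_type']
  refine Fintype.sum_equiv (Equiv.piOptionEquivProd (β := fun _ => Smoothing)) _ _ fun s => ?_
  refine congrArg f (funext fun x => ?_)
  cases x <;> rfl

theorem twistedState_summand (w : (D.twisted c r).V → Smoothing → R) (b : Smoothing)
    (s : D.V → Smoothing) :
    (∏ x, w x (twistedState b s x)) *
        δ ^ ((D.twisted c r).circlesOfState (twistedState b s) - 1) =
      (w (D.oldVertex c r c) (s c) * w (D.newVertex c r) b *
        if r.ClosesCircle (s c) b then δ else 1) *
          stateTermExcept δ (w ∘ D.oldVertex c r) c (update s c (r.add (s c) b)) := by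
  have merged : mergedState (twistedState b s : (D.twisted c r).V → Smoothing) =
    update s c (r.add (s c) b) := rfl
  have prod_twisted : ∏ x, w x (twistedState b s x) =
      w (D.newVertex c r) b * ∏ v, w (D.oldVertex c r v) (s v) :=
    Fintype.prod_option _
  have prod_update : ∏ v ∈ univ.erase c, (w ∘ D.oldVertex c r) v (update s c (r.add (s c) b) v) =
      ∏ v ∈ univ.erase c, w (D.oldVertex c r v) (s v) :=
    prod_congr rfl fun v hv => by rw [update_of_ne (ne_of_mem_erase hv), comp_apply]
  have pow_circles {n : ℕ} (hn : 0 < n) (p : Prop) [Decidable p] :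
      δ ^ (n + (if p then 1 else 0) - 1) = (if p then δ else 1) * δ ^ (n - 1) := by
    split_ifs
    · rw [Nat.sub_add_comm hn, pow_succ']
    · rw [one_mul, add_zero]
  have : Nonempty D.V := ⟨c⟩
  rw [circlesOfState_twisted, merged, pow_circles (D.circlesOfState_pos _), prod_twisted,
    ← mul_prod_erase univ _ (mem_univ c), stateTermExcept, prod_update]
  ring!

theorem stateSum_twisted (w : (D.twisted c r).V → Smoothing → R) :
    (D.twisted c r).stateSum δ w = D.stateSum δ (update (w ∘ D.oldVertex c r) c
      (r.addWeights δ (w (D.oldVertex c r c)) (w (D.newVertex c r)))) := by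
  let coeff (a b : Smoothing) : R :=
    w (D.oldVertex c r c) a * w (D.newVertex c r) b * if r.ClosesCircle a b then δ else 1
  let rest : (D.V → Smoothing) → R := stateTermExcept δ (w ∘ D.oldVertex c r) c
  calc (D.twisted c r).stateSum δ w
    _ = ∑ b, ∑ s : D.V → Smoothing, coeff (s c) b * rest (update s c (r.add (s c) b)) := by
      rw [stateSum, sum_twistedState]
      simp only [twistedState_summand, coeff, rest]
    _ = ∑ b, ∑ a, coeff a b * ∑ s with s c = r.add a b, rest s :=
      sum_congr rfl fun b _ => sum_mul_update rest c (coeff · b) (r.add · b)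
    _ = ∑ s : D.V → Smoothing, (∑ a, ∑ b, if r.add a b = s c then coeff a b else 0) * rest s := by
      simp only [sum_filter, sum_mul, mul_sum]
      rw [sum_comm, sum_comm (s := univ (α := D.V → Smoothing))]
      refine sum_congr rfl fun a _ => Eq.trans ?_ sum_comm
      simp only [eq_comm (b := r.add _ _), ite_mul, mul_ite, zero_mul, mul_zero]
    _ = _ := by
      simp only [stateSum_update, Direction.addWeights, rest, coeff]

theorem Direction.addWeights_single_joint (r : Direction) (u : Smoothing → R) :
    r.addWeights δ u (Pi.single r.joint 1) = u := by
  funext t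
  cases r <;> cases t <;> simp [addWeights, add, ClosesCircle, joint, Smoothing.sum_univ]

theorem Direction.addWeights_single_of_ne {r : Direction} {t : Smoothing} (ht : t ≠ r.joint)
    (u : Smoothing → R) :
    r.addWeights δ u (Pi.single t 1) = Pi.single t (u r.joint + u t * δ) := by
  funext x
  cases r <;> cases t <;> cases x <;>
    simp_all [addWeights, add, ClosesCircle, joint, Smoothing.sum_univ, _root_.add_comm]

end Twisted

section KauffmanBracket

variable (D : LinkDiagram) (c : D.V) (A : ℂ)

theorem weight_smoothed (t : Smoothing) :
    (Elementary.smoothed t).weight A = Pi.single t 1 := by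
  funext s
  exact (Pi.single_apply t 1 s).symm

theorem kauffmanBracket_setKind_eq_stateSum (k : Elementary) :
    (D.setKind c k).kauffmanBracket A = D.stateSum (-A ^ 2 - A⁻¹ ^ 2)
      (update (fun v => (D.kind v).weight A) c (k.weight A)) := by
  refine congrArg (D.stateSum _) (funext fun v => ?_)
  exact apply_update (fun _ (e : Elementary) => e.weight A) D.kind c k v

theorem kauffmanBracket_setKind (k : Elementary) :
    (D.setKind c k).kauffmanBracket A =
      ∑ t, k.weight A t * (D.smooth c t).kauffmanBracket A := by
  rw [kauffmanBracket_setKind_eq_stateSum, stateSum_update_eq_sum]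
  simp only [smooth, kauffmanBracket_setKind_eq_stateSum, weight_smoothed]

theorem setKind_kind_self : D.setKind c (D.kind c) = D := by
  simp only [setKind, update_eq_self]

theorem kauffmanBracket_eq_sum_smooth :
    D.kauffmanBracket A = ∑ t, (D.kind c).weight A t * (D.smooth c t).kauffmanBracket A := by
  rw [← kauffmanBracket_setKind, setKind_kind_self]

end KauffmanBracket

section TwistedBracket

variable {D : LinkDiagram} {c : D.V} {r : Direction} {x : (D.twisted c r).V}

theorem kauffmanBracket_smooth_twisted (hx : x = D.oldVertex c r c ∨ x = D.newVertex c r)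
    (t : Smoothing) (A : ℂ) :
    ((D.twisted c r).smooth x t).kauffmanBracket A = D.stateSum (-A ^ 2 - A⁻¹ ^ 2)
      (update (fun v => (D.kind v).weight A) c
        (r.addWeights (-A ^ 2 - A⁻¹ ^ 2) ((D.kind c).weight A) (Pi.single t 1))) := by
  have old_injective : Injective (D.oldVertex c r) := Option.some_injective _
  have old_ne_new (v : D.V) : D.oldVertex c r v ≠ D.newVertex c r := Option.some_ne_none v
  rw [smooth, kauffmanBracket_setKind_eq_stateSum, stateSum_twisted, weight_smoothed]
  obtain rfl | rfl := hx
  · rw [update_comp_eq_of_injective _ old_injective, update_idem, update_self,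
      update_of_ne (old_ne_new c).symm, Direction.addWeights_comm]
    rfl
  · rw [update_comp_eq_of_forall_ne _ _ old_ne_new, update_self, update_of_ne (old_ne_new c)]
    rfl

theorem kauffmanBracket_smooth_twisted_joint
    (hx : x = D.oldVertex c r c ∨ x = D.newVertex c r) (A : ℂ) :
    ((D.twisted c r).smooth x r.joint).kauffmanBracket A = D.kauffmanBracket A := by
  rw [kauffmanBracket_smooth_twisted hx, Direction.addWeights_single_joint, update_eq_self]
  rfl

theorem kauffmanBracket_smooth_twisted_of_ne
    (hx : x = D.oldVertex c r c ∨ x = D.newVertex c r) {t : Smoothing} (ht : t ≠ r.joint) (A : ℂ) :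
    ((D.twisted c r).smooth x t).kauffmanBracket A =
      ((D.kind c).weight A r.joint + (D.kind c).weight A t * (-A ^ 2 - A⁻¹ ^ 2)) *
        (D.smooth c t).kauffmanBracket A := by
  rw [kauffmanBracket_smooth_twisted hx, Direction.addWeights_single_of_ne _ ht,
    stateSum_update_eq_sum, Fintype.sum_eq_single t, Pi.single_eq_same, smooth,
    kauffmanBracket_setKind_eq_stateSum, weight_smoothed]
  intro b hb
  rw [Pi.single_eq_of_ne hb, zero_mul]

theorem kind_twisted (hx : x = D.oldVertex c r c ∨ x = D.newVertex c r) :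
    (D.twisted c r).kind x = D.kind c := by
  obtain rfl | rfl := hx <;> rfl

theorem crossingNumber_twisted (hc : (D.kind c).IsCrossing) :
    (D.twisted c r).crossingNumber = D.crossingNumber + 1 := by
  let crossings : (D.twisted c r).Cr ≃ Option D.Cr :=
    { toFun := fun
        | ⟨none, _⟩ => none
        | ⟨some v, h⟩ => some ⟨v, h⟩
      invFun := fun
        | none => ⟨D.newVertex c r, hc⟩
        | some v => ⟨D.oldVertex c r v, v.2⟩
      left_inv := by rintro ⟨_ | v, h⟩ <;> rfl
      right_inv := by rintro (_ | v) <;> rfl }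
  rw [crossingNumber, Nat.card_congr crossings, Finite.card_option, crossingNumber]

end TwistedBracket

end LinkDiagram

namespace Elementary

variable {k : Elementary} {A : ℂ}

theorem norm_weight (hk : k.IsCrossing) (hA : ‖A‖ = 1) (t : Smoothing) : ‖k.weight A t‖ = 1 := by
  match k, t, hk with
  | pos, .zero, _ | pos, .infty, _ | neg, .zero, _ | neg, .infty, _ => simp [weight, hA]

theorem weight_mul_weight (hk : k.IsCrossing) (hA : A ≠ 0) {a b : Smoothing} (hab : a ≠ b) :
    k.weight A a * k.weight A b = 1 := by
  match k, a, b, hk, hab with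
  | pos, .zero, .infty, _, _ | pos, .infty, .zero, _, _
  | neg, .zero, .infty, _, _ | neg, .infty, .zero, _, _ => simp [weight, hA]

theorem weight_change (hk : k.IsCrossing) (t : Smoothing) :
    k.change.weight A t = (k.weight A t)⁻¹ := by
  match k, t, hk with
  | pos, .zero, _ | pos, .infty, _ | neg, .zero, _ | neg, .infty, _ => simp [weight, change]

theorem weight_sq (hk : k.IsCrossing) (hA : A ^ 2 + A⁻¹ ^ 2 = 0) {a b : Smoothing} (hab : a ≠ b) :
    k.weight A a ^ 2 = -k.weight A b ^ 2 := by
  match k, a, b, hk, hab with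
  | pos, .infty, .zero, _, _ | neg, .zero, .infty, _, _ => exact eq_neg_of_add_eq_zero_left hA
  | pos, .zero, .infty, _, _ | neg, .infty, .zero, _, _ => exact eq_neg_of_add_eq_zero_right hA

theorem IsCrossing.change (hk : k.IsCrossing) : k.change.IsCrossing := by
  match k, hk with
  | pos, _ | neg, _ => trivial

end Elementary

namespace LinkDiagram

/-- The value of `A` at which the Jones variable `t = A⁻⁴` is `-1`. -/
def detRoot : ℂ := Complex.exp (Real.pi / 4 * Complex.I)

theorem norm_detRoot : ‖detRoot‖ = 1 := by
  have := Complex.norm_exp_ofReal_mul_I (Real.pi / 4)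
  push_cast at this
  exact this

theorem detRoot_sq : detRoot ^ 2 = Complex.I := by
  rw [detRoot, ← Complex.exp_nat_mul]
  convert Complex.exp_pi_div_two_mul_I using 2
  push_cast
  ring

theorem detRoot_sq_add_inv_sq : detRoot ^ 2 + detRoot⁻¹ ^ 2 = 0 := by
  rw [inv_pow, detRoot_sq, Complex.inv_I, add_neg_cancel]

theorem loop_value_detRoot : -detRoot ^ 2 - detRoot⁻¹ ^ 2 = 0 := by
  linear_combination -detRoot_sq_add_inv_sq

section Determinant

variable {D : LinkDiagram} {c : D.V} {r : Direction} {x : (D.twisted c r).V}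

theorem det_eq_norm : D.det = ‖D.kauffmanBracket detRoot‖ := rfl

theorem det_smooth_twisted_joint (hx : x = D.oldVertex c r c ∨ x = D.newVertex c r) :
    ((D.twisted c r).smooth x r.joint).det = D.det := by
  rw [det_eq_norm, kauffmanBracket_smooth_twisted_joint hx, det_eq_norm]

theorem kauffmanBracket_detRoot_smooth_twisted_of_ne
    (hx : x = D.oldVertex c r c ∨ x = D.newVertex c r) {t : Smoothing} (ht : t ≠ r.joint) :
    ((D.twisted c r).smooth x t).kauffmanBracket detRoot =
      (D.kind c).weight detRoot r.joint * (D.smooth c t).kauffmanBracket detRoot := by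
  rw [kauffmanBracket_smooth_twisted_of_ne hx ht, loop_value_detRoot, mul_zero, add_zero]

theorem det_smooth_twisted_of_ne (hc : (D.kind c).IsCrossing)
    (hx : x = D.oldVertex c r c ∨ x = D.newVertex c r) {t : Smoothing} (ht : t ≠ r.joint) :
    ((D.twisted c r).smooth x t).det = (D.smooth c t).det := by
  rw [det_eq_norm, kauffmanBracket_detRoot_smooth_twisted_of_ne hx ht, norm_mul,
    Elementary.norm_weight hc norm_detRoot, one_mul, det_eq_norm]

end Determinant

/-- At the crossing `c`, the contributions of the two smoothings to the Kauffman bracket of which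
the determinant is the absolute value have the same phase. -/
structure Coherent (D : LinkDiagram) (c : D.V) : Prop where
  isCrossing : (D.kind c).IsCrossing
  exists_phase : ∃ U : ℂ, ‖U‖ = 1 ∧ ∀ t,
    (D.kind c).weight detRoot t * (D.smooth c t).kauffmanBracket detRoot = U * (D.smooth c t).det

section Coherent

variable {D : LinkDiagram} {c : D.V} {r : Direction} {x : (D.twisted c r).V}

theorem Coherent.det_eq_sum (h : D.Coherent c) : D.det = ∑ t, (D.smooth c t).det := by
  obtain ⟨U, norm_U, hU⟩ := h.exists_phase
  have det_nonneg : 0 ≤ ∑ t, (D.smooth c t).det := sum_nonneg fun t _ => norm_nonneg _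
  rw [det_eq_norm, D.kauffmanBracket_eq_sum_smooth c, sum_congr rfl fun t _ => hU t, ← mul_sum,
    ← Complex.ofReal_sum, norm_mul, norm_U, one_mul, Complex.norm_of_nonneg det_nonneg]

theorem Coherent.twisted (h : D.Coherent c)
    (hx : x = D.oldVertex c r c ∨ x = D.newVertex c r) : (D.twisted c r).Coherent x := by
  obtain ⟨U, norm_U, hU⟩ := h.exists_phase
  refine ⟨kind_twisted hx ▸ h.isCrossing, (D.kind c).weight detRoot r.joint * U, ?_, fun t => ?_⟩
  · rw [norm_mul, norm_U, Elementary.norm_weight h.isCrossing norm_detRoot, one_mul]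
  · rw [kind_twisted hx]
    by_cases ht : t = r.joint
    · have bracket_eq : D.kauffmanBracket detRoot = U * D.det := by
        rw [D.kauffmanBracket_eq_sum_smooth c, sum_congr rfl fun t _ => hU t, ← mul_sum,
          ← Complex.ofReal_sum, ← h.det_eq_sum]
      rw [ht, kauffmanBracket_smooth_twisted_joint hx, det_smooth_twisted_joint hx, bracket_eq,
        mul_assoc]
    · rw [kauffmanBracket_detRoot_smooth_twisted_of_ne hx ht,
        det_smooth_twisted_of_ne h.isCrossing hx ht, mul_left_comm, hU, mul_assoc]

theorem smooth_crossingChange (t : Smoothing) :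
    (D.crossingChange c).smooth c t = D.smooth c t :=
  congrArg (fun κ => ({ D with kind := κ } : LinkDiagram)) (update_idem ..)

theorem exists_phase_of_coherent_crossingChange (hc : (D.kind c).IsCrossing)
    (h : (D.crossingChange c).Coherent c) :
    ∃ U : ℂ, ‖U‖ = 1 ∧ ∀ t, (D.smooth c t).kauffmanBracket detRoot =
      U * ((D.kind c).weight detRoot t * (D.smooth c t).det) := by
  obtain ⟨U, norm_U, hU⟩ := h.exists_phase
  refine ⟨U, norm_U, fun t => ?_⟩
  have kind_eq : (D.crossingChange c).kind c = (D.kind c).change := update_self ..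
  have weight_ne_zero : (D.kind c).weight detRoot t ≠ 0 := by
    rw [← norm_ne_zero_iff, Elementary.norm_weight hc norm_detRoot]
    exact one_ne_zero
  have hUt := hU t
  rw [smooth_crossingChange, kind_eq, Elementary.weight_change hc,
    inv_mul_eq_iff_eq_mul₀ weight_ne_zero] at hUt
  rw [hUt]
  ring

theorem kauffmanBracket_of_coherent_crossingChange (hc : (D.kind c).IsCrossing)
    {U : ℂ} (hU : ∀ t, (D.smooth c t).kauffmanBracket detRoot =
      U * ((D.kind c).weight detRoot t * (D.smooth c t).det))
    {a b : Smoothing} (hab : a ≠ b) :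
    D.kauffmanBracket detRoot =
      U * (D.kind c).weight detRoot b ^ 2 * ((D.smooth c b).det - (D.smooth c a).det : ℝ) := by
  have weight_sq := Elementary.weight_sq hc detRoot_sq_add_inv_sq hab
  rw [D.kauffmanBracket_eq_sum_smooth c, Smoothing.sum_eq_add hab, hU, hU]
  push_cast
  linear_combination U * (D.smooth c a).det * weight_sq

theorem det_of_coherent_crossingChange (hc : (D.kind c).IsCrossing)
    (h : (D.crossingChange c).Coherent c) {a b : Smoothing} (hab : a ≠ b) :
    D.det = |(D.smooth c b).det - (D.smooth c a).det| := by
  obtain ⟨U, norm_U, hU⟩ := exists_phase_of_coherent_crossingChange hc h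
  rw [det_eq_norm, kauffmanBracket_of_coherent_crossingChange hc hU hab, norm_mul, norm_mul,
    norm_pow, norm_U, Elementary.norm_weight hc norm_detRoot, one_pow, one_mul, one_mul,
    Complex.norm_real, Real.norm_eq_abs]

theorem twisted_coherent_of_coherent_crossingChange (hc : (D.kind c).IsCrossing)
    (h : (D.crossingChange c).Coherent c) {t : Smoothing} (ht : t ≠ r.joint)
    (det_le : (D.smooth c r.joint).det ≤ (D.smooth c t).det)
    (hx : x = D.oldVertex c r c ∨ x = D.newVertex c r) : (D.twisted c r).Coherent x := by
  obtain ⟨U, norm_U, hU⟩ := exists_phase_of_coherent_crossingChange hc h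
  have detRoot_ne_zero : detRoot ≠ 0 := Complex.exp_ne_zero _
  have weight_mul := Elementary.weight_mul_weight hc detRoot_ne_zero ht
  refine ⟨kind_twisted hx ▸ hc, U * (D.kind c).weight detRoot t, ?_, fun a => ?_⟩
  · rw [norm_mul, norm_U, Elementary.norm_weight hc norm_detRoot, one_mul]
  · rw [kind_twisted hx]
    by_cases ha : a = r.joint
    · have det_eq : (D.smooth c t).det - (D.smooth c r.joint).det = D.det := by
        rw [det_of_coherent_crossingChange hc h ht.symm, abs_of_nonneg (sub_nonneg.2 det_le)]
      rw [ha, kauffmanBracket_smooth_twisted_joint hx, det_smooth_twisted_joint hx,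
        kauffmanBracket_of_coherent_crossingChange hc hU ht.symm, det_eq]
      linear_combination U * (D.kind c).weight detRoot t * D.det * weight_mul
    · obtain rfl := Smoothing.eq_of_ne_of_ne ha ht
      rw [kauffmanBracket_detRoot_smooth_twisted_of_ne hx ha, det_smooth_twisted_of_ne hc hx ha, hU]
      linear_combination U * (D.kind c).weight detRoot a * (D.smooth c a).det * weight_mul

end Coherent

/-- At the crossing `c` of a diagram without more crossings than its determinant, a twist in either
direction increases the determinant by at least one. This passes on to rational extensions. -/
structure TwistStable (D : LinkDiagram) (c : D.V) : Prop where
  coherent : D.Coherent c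
  one_le_det_smooth (t : Smoothing) : 1 ≤ (D.smooth c t).det
  crossingNumber_le : (D.crossingNumber : ℝ) ≤ D.det

section TwistStable

variable {D : LinkDiagram} {c : D.V} {r : Direction}

theorem crossingNumber_pos (hc : (D.kind c).IsCrossing) : 0 < D.crossingNumber :=
  Nat.card_pos_iff.2 ⟨⟨c, hc⟩, inferInstance⟩

theorem twistStable_twisted {x : (D.twisted c r).V} (hc : (D.kind c).IsCrossing)
    (hle : (D.crossingNumber : ℝ) ≤ D.det) {t : Smoothing} (ht : t ≠ r.joint)
    (one_le : 1 ≤ (D.smooth c t).det) (hx : x = D.oldVertex c r c ∨ x = D.newVertex c r)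
    (coherent : (D.twisted c r).Coherent x) : (D.twisted c r).TwistStable x := by
  have det_joint := det_smooth_twisted_joint hx
  have det_other := det_smooth_twisted_of_ne hc hx ht
  refine ⟨coherent, fun a => ?_, ?_⟩
  · by_cases ha : a = r.joint
    · have one_le_crossingNumber : (1 : ℝ) ≤ D.crossingNumber := mod_cast crossingNumber_pos hc
      rw [ha, det_joint]
      exact one_le_crossingNumber.trans hle
    · rw [Smoothing.eq_of_ne_of_ne ha ht, det_other]
      exact one_le
  · rw [crossingNumber_twisted hc, coherent.det_eq_sum, Smoothing.sum_eq_add ht, det_joint,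
      det_other]
    push_cast
    linarith

theorem TwistStable.twisted {x : (D.twisted c r).V} (h : D.TwistStable c)
    (hx : x = D.oldVertex c r c ∨ x = D.newVertex c r) : (D.twisted c r).TwistStable x := by
  obtain ⟨t, ht⟩ := exists_ne r.joint
  exact twistStable_twisted h.coherent.isCrossing h.crossingNumber_le ht (h.one_le_det_smooth t) hx
    (h.coherent.twisted hx)

theorem forall_twist_of_forall_twisted {P : ∀ E : LinkDiagram, E.V → Prop}
    (h : ∀ x, x = D.oldVertex c r c ∨ x = D.newVertex c r → P (D.twisted c r) x) :
    ∀ x, x = D.oldCrossing c r ∨ x = D.newCrossing c r → P (D.twist c r) x := by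
  cases r <;> exact h

theorem TwistStable.iterate_twistStep {p : Σ D : LinkDiagram, D.V} (h : p.1.TwistStable p.2)
    (n : ℕ) : ((twistStep r)^[n] p).1.TwistStable ((twistStep r)^[n] p).2 := by
  induction n with
  | zero => exact h
  | succ n ih =>
    rw [iterate_succ_apply']
    exact forall_twist_of_forall_twisted (P := TwistStable) (fun _ => ih.twisted) _ (.inl rfl)

theorem TwistStable.insertTangle {p : Σ D : LinkDiagram, D.V} (h : p.1.TwistStable p.2)
    (r : Direction) (a : List ℕ) :
    (insertTangle r a p).1.TwistStable (insertTangle r a p).2 := by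
  fun_induction LinkDiagram.insertTangle r a p with
  | case1 => exact h
  | case2 => exact h.iterate_twistStep _
  | case3 _ _ _ _ _ ih => exact ih (h.iterate_twistStep _)

theorem TwistStable.crossingNumber_rationalExtension_le (h : D.TwistStable c) (a : List ℕ) :
    ((D.rationalExtension c a).crossingNumber : ℝ) ≤ (D.rationalExtension c a).det :=
  (TwistStable.insertTangle (p := ⟨D, c⟩) h .horizontal a).crossingNumber_le

end TwistStable

end LinkDiagram

namespace Smoothing

/-- A smoothing merges the two opposite corners which, in counterclockwise order, precede the
ends `t.mergedEnd` and `t.mergedEnd + 2`. -/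
def mergedEnd : Smoothing → Fin 4
  | .zero => 1
  | .infty => 0

theorem apply_arc_eq_apply_add_one {β : Type*} {t : Smoothing} {g : Fin 4 → β}
    (hg : g t.mergedEnd = g (t.mergedEnd + 2)) (i : Fin 4) : g (t.arc i) = g (i + 1) := by
  cases t <;> fin_cases i <;> first | rfl | exact hg | exact hg.symm

end Smoothing

namespace Elementary

instance : DecidablePred IsCrossing
  | smoothed _ => isFalse not_false
  | pos => isTrue trivial
  | neg => isTrue trivial

/-- The end through which the boundary of a face leaves an elementary tangle that it enters at the
end `i`, when it keeps the face on a fixed side. -/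
def turn : Elementary → Fin 4 → Fin 4
  | smoothed t, i => t.arc i
  | pos, i => i + 1
  | neg, i => i + 1

variable {k : Elementary}

theorem exists_eq_smoothed (hk : ¬ k.IsCrossing) : ∃ t, k = smoothed t := by
  match k, hk with
  | smoothed t, _ => exact ⟨t, rfl⟩
  | pos, hk | neg, hk => exact absurd trivial hk

theorem turn_of_isCrossing (hk : k.IsCrossing) (i : Fin 4) : k.turn i = i + 1 := by
  match k, hk with
  | pos, _ | neg, _ => rfl

theorem isOver_add_one (hk : k.IsCrossing) (i : Fin 4) : k.isOver (i + 1) = !k.isOver i := by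
  match k, hk with
  | pos, _ | neg, _ => decide +revert

theorem isOver_arc (hk : k.IsCrossing) (t : Smoothing) (i : Fin 4) :
    k.isOver (t.arc i) = !k.isOver i := by
  match k, hk with
  | pos, _ | neg, _ => decide +revert

theorem arc_eq_add_one_of_isOver_eq (hk : k.IsCrossing) {t : Smoothing} {i : Fin 4}
    (hi : k.isOver i = k.isOver t.mergedEnd) : t.arc i = i + 1 := by
  match k, hk with
  | pos, _ | neg, _ => decide +revert

theorem weight_eq_ite (hk : k.IsCrossing) (A : ℂ) (t : Smoothing) :
    k.weight A t = if k.isOver t.mergedEnd then A⁻¹ else A := by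
  match k, t, hk with
  | pos, .zero, _ | pos, .infty, _ | neg, .zero, _ | neg, .infty, _ => rfl

end Elementary

namespace LinkDiagram

/-- The labels over (`true`) and under (`false`) of the ends of edges that witness that a diagram
is alternating. -/
structure IsAlternatingLabelling (D : LinkDiagram) (o : D.Dart → Bool) : Prop where
  glue (d : D.Dart) : o (D.glue d) = !o d
  crossing (v : D.V) (i : Fin 4) (hv : (D.kind v).IsCrossing) : o (v, i) = (D.kind v).isOver i
  arc (v : D.V) (i : Fin 4) (t : Smoothing) (hv : D.kind v = .smoothed t) :
    o (v, t.arc i) = !o (v, i)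

/-- A state is admissible if it agrees with the diagram at the vertices that are not crossings;
the other states do not contribute to the Kauffman bracket. -/
def Admissible (D : LinkDiagram) (s : D.V → Smoothing) : Prop :=
  ∀ v t, D.kind v = .smoothed t → s v = t

section Faces

variable (D : LinkDiagram) (o : D.Dart → Bool) (s : D.V → Smoothing) (b : Bool)

/-- The rational functions on the faces of the diagram; the value on a face is attached to the ends
of edges through which the boundary of the face leaves a vertex. Unlike the faces of the underlying
map, two regions merged by a vertex that is not a crossing form a single face. -/
def faceFunctions : Submodule ℚ (D.Dart → ℚ) where
  carrier := {f | ∀ v i, f (v, (D.kind v).turn i) = f (D.glue (v, i))}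
  add_mem' hf hg v i := by simp only [Pi.add_apply, hf v i, hg v i]
  zero_mem' _ _ := rfl
  smul_mem' a f hf v i := by simp only [Pi.smul_apply, hf v i]

/-- The functions which vanish on the faces that are not labelled `b`. In an alternating diagram,
the labels `true` and `false` are the colours of a checkerboard colouring. -/
def coloredFaceFunctions : Submodule ℚ (D.Dart → ℚ) where
  carrier := {f | f ∈ D.faceFunctions ∧ ∀ d, o d ≠ b → f d = 0}
  add_mem' hf hg := ⟨add_mem hf.1 hg.1, fun d hd => by
    rw [Pi.add_apply, hf.2 d hd, hg.2 d hd, add_zero]⟩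
  zero_mem' := ⟨zero_mem _, fun _ _ => rfl⟩
  smul_mem' a _ hf := ⟨Submodule.smul_mem _ a hf.1, fun d hd => by
    rw [Pi.smul_apply, hf.2 d hd, smul_zero]⟩

/-- The difference of the values on the two faces which a state merges at a vertex. -/
def mergedDifference (v : D.V) : Module.Dual ℚ (D.Dart → ℚ) :=
  LinearMap.proj (R := ℚ) (φ := fun _ : D.Dart => ℚ) (v, (s v).mergedEnd) -
    LinearMap.proj (v, (s v).mergedEnd + 2)

/-- The crossings at which a state merges two faces labelled `b`. -/
def mergingCrossings : Finset D.V :=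
  {v | (D.kind v).IsCrossing ∧ (D.kind v).isOver (s v).mergedEnd = b}

variable {D o s b}

theorem apply_arc_of_mergedDifference_eq_zero {f : D.Dart → ℚ} {v : D.V}
    (h : D.mergedDifference s v f = 0) (i : Fin 4) : f (v, (s v).arc i) = f (v, i + 1) :=
  Smoothing.apply_arc_eq_apply_add_one (g := fun i => f (v, i)) (sub_eq_zero.1 h) i

/-- By Euler's formula, the underlying map has at least two more faces than vertices, and each
vertex that is not a crossing merges two of them. -/
theorem card_add_two_le_finrank_faceFunctions [Nonempty D.V] (hD : D.Planar)
    (hs : D.Admissible s) :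
    Fintype.card D.V + 2 ≤
      Module.finrank ℚ D.faceFunctions + #{v | ¬ (D.kind v).IsCrossing} := by
  have card_le : Fintype.card D.V + 2 ≤
      Module.finrank ℚ (invariantFunctions {rot D.V * D.glue} ℚ) := by
    have components_pos := numOrbits_pos ({rot D.V, D.glue} : Set (Equiv.Perm D.Dart))
    rw [finrank_invariantFunctions, hD]
    omega
  refine card_le.trans (finrank_le_finrank_add_card _ (D.mergedDifference s) ?_)
  intro f hf merged v i
  have rotated : f (v, i + 1) = f (D.glue (v, i)) := by
    have h : f (rot D.V (D.glue (D.glue (v, i)))) = f (D.glue (v, i)) := hf _ rfl _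
    rw [D.glue_glue] at h
    exact h
  by_cases hv : (D.kind v).IsCrossing
  · rw [Elementary.turn_of_isCrossing hv, rotated]
  · obtain ⟨t, ht⟩ := Elementary.exists_eq_smoothed hv
    rw [ht, Elementary.turn, ← hs v t ht, ← rotated]
    exact apply_arc_of_mergedDifference_eq_zero (merged v (mem_filter.2 ⟨mem_univ v, hv⟩)) i

namespace IsAlternatingLabelling

variable (ho : D.IsAlternatingLabelling o)

include ho

theorem turn (v : D.V) (i : Fin 4) : o (v, (D.kind v).turn i) = !o (v, i) := by
  by_cases hv : (D.kind v).IsCrossing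
  · rw [Elementary.turn_of_isCrossing hv, ho.crossing v _ hv, ho.crossing v _ hv,
      Elementary.isOver_add_one hv]
  · obtain ⟨t, ht⟩ := Elementary.exists_eq_smoothed hv
    rw [ht]
    exact ho.arc v i t ht

theorem state_arc (hs : D.Admissible s) (v : D.V) (i : Fin 4) :
    o (v, (s v).arc i) = !o (v, i) := by
  by_cases hv : (D.kind v).IsCrossing
  · rw [ho.crossing v _ hv, ho.crossing v _ hv, Elementary.isOver_arc hv]
  · obtain ⟨t, ht⟩ := Elementary.exists_eq_smoothed hv
    rw [hs v t ht]
    exact ho.arc v i t ht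

theorem finrank_faceFunctions_le : Module.finrank ℚ D.faceFunctions ≤
    Module.finrank ℚ (D.coloredFaceFunctions o true) +
      Module.finrank ℚ (D.coloredFaceFunctions o false) := by
  refine (Submodule.finrank_mono fun f hf => ?_).trans
    (Submodule.finrank_add_le_finrank_add_finrank _ _)
  have restriction_mem (b : Bool) :
      (fun d => if o d = b then f d else 0) ∈ D.coloredFaceFunctions o b := by
    refine ⟨fun v i => ?_, fun d hd => if_neg hd⟩
    simp only [ho.turn, ho.glue, hf v i]
  refine Submodule.mem_sup.2 ⟨_, restriction_mem true, _, restriction_mem false, ?_⟩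
  ext d
  cases h : o d <;> simp [h]

variable {f : D.Dart → ℚ}

/-- Where a state does not merge faces labelled `b`, its arcs run along them. -/
theorem apply_arc_eq_apply_glue (hs : D.Admissible s) (hf : f ∈ D.coloredFaceFunctions o b)
    (merged : ∀ v ∈ D.mergingCrossings s b, D.mergedDifference s v f = 0) {v : D.V} {i : Fin 4}
    (hi : o (v, i) ≠ b) : f (v, (s v).arc i) = f (D.glue (v, i)) := by
  rw [← hf.1 v i]
  by_cases hv : (D.kind v).IsCrossing
  · rw [Elementary.turn_of_isCrossing hv]
    by_cases merges : (D.kind v).isOver (s v).mergedEnd = b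
    · exact apply_arc_of_mergedDifference_eq_zero
        (merged v (mem_filter.2 ⟨mem_univ v, hv, merges⟩)) i
    · rw [ho.crossing v i hv] at hi
      rw [Elementary.arc_eq_add_one_of_isOver_eq hv
        ((Bool.eq_not.2 hi).trans (Bool.eq_not.2 merges).symm)]
  · obtain ⟨t, ht⟩ := Elementary.exists_eq_smoothed hv
    rw [hs v t ht, ht, Elementary.turn]

theorem add_apply_glue_eq (hs : D.Admissible s) (single : D.circlesOfState s ≤ 1)
    (hf : f ∈ D.coloredFaceFunctions o b)
    (merged : ∀ v ∈ D.mergingCrossings s b, D.mergedDifference s v f = 0) (d e : D.Dart) :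
    f d + f (D.glue d) = f e + f (D.glue e) := by
  have along_arc {v : D.V} {i : Fin 4} (hi : o (v, i) ≠ b) :
      f (v, (s v).arc i) + f (D.glue (v, (s v).arc i)) = f (v, i) + f (D.glue (v, i)) := by
    have glue_arc_ne : o (D.glue (v, (s v).arc i)) ≠ b := by
      rwa [ho.glue, ho.state_arc hs, Bool.not_not]
    rw [ho.apply_arc_eq_apply_glue hs hf merged hi, hf.2 _ glue_arc_ne, hf.2 _ hi, add_comm]
  refine apply_eq_apply_of_circlesOfState_le_one single (f := fun d => f d + f (D.glue d))
    (fun d => ?_) (fun v i => ?_) d e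
  · rw [D.glue_glue, add_comm]
  · by_cases hi : o (v, i) = b
    · have arc_ne : o (v, (s v).arc i) ≠ b := by
        rw [ho.state_arc hs, hi]
        exact Bool.not_ne_self b
      simpa only [Smoothing.arc_arc] using (along_arc arc_ne).symm
    · exact along_arc hi

theorem finrank_coloredFaceFunctions_le (hs : D.Admissible s) (single : D.circlesOfState s ≤ 1)
    (b : Bool) :
    Module.finrank ℚ (D.coloredFaceFunctions o b) ≤ 1 + #(D.mergingCrossings s b) := by
  let indicator : D.Dart → ℚ := fun d => if o d = b then 1 else 0
  have span_le : Module.finrank ℚ (Submodule.span ℚ {indicator}) ≤ 1 := by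
    simpa using finrank_span_le_card (R := ℚ) {indicator}
  refine le_trans (finrank_le_finrank_add_card _ (D.mergedDifference s) fun f hf merged => ?_)
    (Nat.add_le_add_right span_le _)
  rcases isEmpty_or_nonempty D.Dart with _ | ⟨⟨e⟩⟩
  · rw [Subsingleton.elim f 0]
    exact zero_mem _
  refine Submodule.mem_span_singleton.2 ⟨f e + f (D.glue e), funext fun d => ?_⟩
  rw [Pi.smul_apply, smul_eq_mul, ← ho.add_apply_glue_eq hs single hf merged d e]
  by_cases hd : o d = b
  · have glue_ne : o (D.glue d) ≠ b := by
      rw [ho.glue, hd]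
      exact Bool.not_ne_self b
    rw [hf.2 _ glue_ne, add_zero, show indicator d = 1 from if_pos hd, mul_one]
  · rw [show indicator d = 0 from if_neg hd, mul_zero, hf.2 d hd]

theorem finrank_coloredFaceFunctions [Nonempty D.V] (hD : D.Planar) (hs : D.Admissible s)
    (single : D.circlesOfState s ≤ 1) (b : Bool) :
    Module.finrank ℚ (D.coloredFaceFunctions o b) = 1 + #(D.mergingCrossings s b) := by
  have faces := card_add_two_le_finrank_faceFunctions hD hs
  have colored := ho.finrank_faceFunctions_le
  have colored_true := ho.finrank_coloredFaceFunctions_le hs single true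
  have colored_false := ho.finrank_coloredFaceFunctions_le hs single false
  have crossings := card_filter_add_card_filter_not (s := univ)
    fun v => (D.kind v).IsCrossing
  have merging := card_filter_add_card_filter_not
    (s := ({v | (D.kind v).IsCrossing} : Finset D.V))
    fun v => (D.kind v).isOver (s v).mergedEnd = true
  simp only [filter_filter, Bool.not_eq_true] at merging
  rw [card_univ] at crossings
  unfold mergingCrossings at *
  cases b <;> omega

end IsAlternatingLabelling

end Faces

section Weights

variable {D : LinkDiagram} {s : D.V → Smoothing}

theorem prod_weight_eq_zero (A : ℂ) (hs : ¬ D.Admissible s) :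
    ∏ v, (D.kind v).weight A (s v) = 0 := by
  simp only [Admissible, not_forall] at hs
  obtain ⟨v, t, hv, ne⟩ := hs
  refine prod_eq_zero (mem_univ v) ?_
  rw [hv]
  exact if_neg ne

theorem weight_eq_mul (A : ℂ) (hs : D.Admissible s) (v : D.V) :
    (D.kind v).weight A (s v) = (if v ∈ D.mergingCrossings s true then A⁻¹ else 1) *
      if v ∈ D.mergingCrossings s false then A else 1 := by
  by_cases hv : (D.kind v).IsCrossing
  · rw [Elementary.weight_eq_ite hv]
    cases h : (D.kind v).isOver (s v).mergedEnd <;> simp [mergingCrossings, hv, h]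
  · obtain ⟨t, ht⟩ := Elementary.exists_eq_smoothed hv
    have notMem (b : Bool) : v ∉ D.mergingCrossings s b := fun h => hv (mem_filter.1 h).2.1
    rw [if_neg (notMem true), if_neg (notMem false), mul_one, ht, hs v t ht]
    exact if_pos rfl

theorem prod_weight_eq (A : ℂ) (hs : D.Admissible s) : ∏ v, (D.kind v).weight A (s v) =
    A⁻¹ ^ #(D.mergingCrossings s true) * A ^ #(D.mergingCrossings s false) := by
  simp only [weight_eq_mul A hs, prod_mul_distrib, prod_ite_mem, univ_inter, prod_const]

theorem Alternating.exists_prod_weight_eq [Nonempty D.V] (hD : D.Planar) (h : D.Alternating)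
    {A : ℂ} (hA : ‖A‖ = 1) :
    ∃ W : ℂ, ‖W‖ = 1 ∧ ∀ s, D.Admissible s → D.circlesOfState s ≤ 1 →
      ∏ v, (D.kind v).weight A (s v) = W := by
  obtain ⟨o, glue, crossing, arc⟩ := h
  have ho : D.IsAlternatingLabelling o := ⟨glue, crossing, arc⟩
  let exponent (b : Bool) := Module.finrank ℚ (D.coloredFaceFunctions o b) - 1
  refine ⟨A⁻¹ ^ exponent true * A ^ exponent false, by simp [hA], fun s hs single => ?_⟩
  simp only [exponent, ho.finrank_coloredFaceFunctions hD hs single, Nat.add_sub_cancel_left]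
  exact prod_weight_eq A hs

end Weights

section AlternatingCoherent

variable {D : LinkDiagram}

theorem weight_mul_kauffmanBracket_smooth (c : D.V) (t : Smoothing) (A : ℂ) :
    (D.kind c).weight A t * (D.smooth c t).kauffmanBracket A =
      ∑ s with s c = t, (∏ v, (D.kind v).weight A (s v)) *
        (-A ^ 2 - A⁻¹ ^ 2) ^ (D.circlesOfState s - 1) := by
  rw [smooth, kauffmanBracket_setKind_eq_stateSum, stateSum_update, weight_smoothed, mul_sum,
    sum_filter]
  refine sum_congr rfl fun s _ => ?_
  rw [prod_mul_pow_eq_mul_stateTermExcept _ (fun v => (D.kind v).weight A) c s, Pi.single_apply]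
  split_ifs with h
  · rw [h, one_mul]
  · rw [zero_mul, mul_zero]

open Classical in
theorem Alternating.coherent (hD : D.Planar) (h : D.Alternating) {c : D.V}
    (hc : (D.kind c).IsCrossing) : D.Coherent c := by
  have : Nonempty D.V := ⟨c⟩
  obtain ⟨W, norm_W, hW⟩ := h.exists_prod_weight_eq hD norm_detRoot
  let contributing (t : Smoothing) : Finset (D.V → Smoothing) :=
    {s | s c = t ∧ D.Admissible s ∧ D.circlesOfState s ≤ 1}
  have bracket_eq (t : Smoothing) : (D.kind c).weight detRoot t *
      (D.smooth c t).kauffmanBracket detRoot = W * #(contributing t) := by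
    have term_eq (s : D.V → Smoothing) : (∏ v, (D.kind v).weight detRoot (s v)) *
        (-detRoot ^ 2 - detRoot⁻¹ ^ 2) ^ (D.circlesOfState s - 1) =
          if D.Admissible s ∧ D.circlesOfState s ≤ 1 then W else 0 := by
      rw [loop_value_detRoot]
      by_cases hs : D.Admissible s
      · by_cases single : D.circlesOfState s ≤ 1
        · rw [if_pos ⟨hs, single⟩, hW s hs single, Nat.sub_eq_zero_of_le single, pow_zero, mul_one]
        · rw [if_neg fun h => single h.2, zero_pow (by omega), mul_zero]
      · rw [if_neg fun h => hs h.1, prod_weight_eq_zero _ hs, zero_mul]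
    rw [weight_mul_kauffmanBracket_smooth, sum_congr rfl fun s _ => term_eq s, ← sum_filter,
      filter_filter, sum_const, nsmul_eq_mul, mul_comm]
  have det_eq (t : Smoothing) : (D.smooth c t).det = #(contributing t) := by
    have norm_eq := congrArg norm (bracket_eq t)
    rwa [norm_mul, norm_mul, norm_W, Elementary.norm_weight hc norm_detRoot, one_mul, one_mul,
      Complex.norm_natCast] at norm_eq
  refine ⟨hc, W, norm_W, fun t => ?_⟩
  rw [bracket_eq, det_eq, Complex.ofReal_natCast]

end AlternatingCoherent

variable {D : LinkDiagram} {c : D.V} {r : Direction}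

theorem IsDealternator.coherent_crossingChange (h : D.IsDealternator c) (hD : D.Planar) :
    (D.crossingChange c).Coherent c := by
  have kind_eq : (D.crossingChange c).kind c = (D.kind c).change := update_self ..
  exact Alternating.coherent (D := D.crossingChange c) hD h.2 (kind_eq ▸ h.1.change)

theorem IsDealternator.twistStable_twisted (h : D.IsDealternator c) (hD : D.Planar)
    (hle : (D.crossingNumber : ℝ) ≤ D.det) {t : Smoothing} (ht : t ≠ r.joint)
    (det_lt : (D.smooth c r.joint).det < (D.smooth c t).det) {x : (D.twisted c r).V}
    (hx : x = D.oldVertex c r c ∨ x = D.newVertex c r) : (D.twisted c r).TwistStable x := by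
  have coherent_change := h.coherent_crossingChange hD
  have one_le_crossingNumber : (1 : ℝ) ≤ D.crossingNumber := mod_cast crossingNumber_pos h.1
  have det_eq := det_of_coherent_crossingChange h.1 coherent_change ht.symm
  rw [abs_of_pos (sub_pos.2 det_lt)] at det_eq
  have joint_nonneg : 0 ≤ (D.smooth c r.joint).det := norm_nonneg _
  exact LinkDiagram.twistStable_twisted h.1 hle ht (by linarith) hx
    (twisted_coherent_of_coherent_crossingChange h.1 coherent_change ht det_lt.le hx)

theorem IsDealternator.twistStable_twist (h : D.IsDealternator c) (hD : D.Planar)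
    (hle : (D.crossingNumber : ℝ) ≤ D.det) {t : Smoothing} (ht : t ≠ r.joint)
    (det_lt : (D.smooth c r.joint).det < (D.smooth c t).det) (x : (D.twist c r).V)
    (hx : x = D.oldCrossing c r ∨ x = D.newCrossing c r) : (D.twist c r).TwistStable x :=
  forall_twist_of_forall_twisted (P := TwistStable)
    (fun _ => h.twistStable_twisted hD hle ht det_lt) x hx

theorem IsDealternator.det_smooth_ne (h : D.IsDealternator c) (hD : D.Planar)
    (det_pos : 0 < D.det) : (D.smooth c .zero).det ≠ (D.smooth c .infty).det := by
  rw [det_of_coherent_crossingChange h.1 (h.coherent_crossingChange hD)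
    (show Smoothing.infty ≠ .zero by decide), abs_pos, sub_ne_zero] at det_pos
  exact det_pos

end LinkDiagram

theorem mainTheorem12_general (D : LinkDiagram) (hD : D.Planar) (c : D.V)
    (hdealt : D.IsDealternator c) (hle : (D.crossingNumber : ℝ) ≤ D.det) :
    (D.smooth c .zero).det ≠ (D.smooth c .infty).det ∧
    ∀ r : LinkDiagram.Direction,
      (r = .vertical ∧ (D.smooth c .infty).det < (D.smooth c .zero).det ∨
        r = .horizontal ∧ (D.smooth c .zero).det < (D.smooth c .infty).det) →
      ∀ x : (D.twist c r).V, (x = D.oldCrossing c r ∨ x = D.newCrossing c r) →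
      ∀ a : List ℕ, LinkDiagram.IsExtensionTuple a →
        (((D.twist c r).rationalExtension x a).crossingNumber : ℝ) ≤
          ((D.twist c r).rationalExtension x a).det := by
  have crossingNumber_pos : (0 : ℝ) < D.crossingNumber :=
    mod_cast LinkDiagram.crossingNumber_pos hdealt.1
  refine ⟨hdealt.det_smooth_ne hD (crossingNumber_pos.trans_le hle), fun r hr x hx a _ => ?_⟩
  obtain ⟨t, ht, det_lt⟩ :
      ∃ t, t ≠ r.joint ∧ (D.smooth c r.joint).det < (D.smooth c t).det := by
    obtain ⟨rfl, h⟩ | ⟨rfl, h⟩ := hr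
    exacts [⟨.zero, nofun, h⟩, ⟨.infty, nofun, h⟩]
  exact (hdealt.twistStable_twist hD hle ht det_lt x hx).crossingNumber_rationalExtension_le a

end

theorem mainTheorem12 (D : LinkDiagram) (hD : D.Planar) (c : D.V) (hc : D.kind c = .neg)
    (hdealt : D.IsDealternator c) (hQ : D.QuasiAlternating)
    (hle : (D.crossingNumber : ℝ) ≤ D.det) :
    (D.smooth c .zero).det ≠ (D.smooth c .infty).det ∧
    ∀ r : LinkDiagram.Direction,
      (r = .vertical ∧ (D.smooth c .infty).det < (D.smooth c .zero).det ∨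
        r = .horizontal ∧ (D.smooth c .zero).det < (D.smooth c .infty).det) →
      ∀ x : (D.twist c r).V, (x = D.oldCrossing c r ∨ x = D.newCrossing c r) →
      ∀ a : List ℕ, LinkDiagram.IsExtensionTuple a →
        (((D.twist c r).rationalExtension x a).crossingNumber : ℝ) ≤
          ((D.twist c r).rationalExtension x a).det :=
  mainTheorem12_general D hD c hdealt hle
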